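/- For an operator $L$ on $\mathbb{C}^d$ let $\mathcal{L}_L(\rho)=L\rho L^\dagger-\tfrac12\{L^\dagger L,\rho\}$, let $|L\rangle=\sum_{i,j}L_{ij}|i\rangle|j\rangle\in\mathbb{C}^d\otimes\mathbb{C}^d$, and let $\pi_L=|L\rangle\langle L|$ be the associated program state. For a random $L$, the typical sample complexity $\overline{n}_d(t,\varepsilon,\delta)$ is the least $n\in\mathbb{N}=\{0,1,2,\dots\}$ for which there is a completely positive trace-preserving map $\mathcal{P}$, independent of $L$, from operators on $\mathbb{C}^d\otimes(\mathbb{C}^d\otimes\mathbb{C}^d)^{\otimes n}$ to operators on $\mathbb{C}^d$ such that $$\Pr_L\Big[\tfrac12\big\|\mathcal{P}(\,\cdot\,\otimes\pi_L^{\otimes n})-e^{\mathcal{L}_Lt}\big\|_\diamond\le\varepsilon\Big]\ge1-\delta .$$ **Theorem.** Let $d\ge2$, let $G\in\mathbb{C}^{d\times d}$ be a complex Ginibre matrix (independent complex Gaussian entries with mean zero and unit variance), and let $L=G/\|G\|_2$, where $\|\cdot\|_2$ is the Frobenius norm. Then $|L\rangle$ is uniformly (Haar) distributed on the unit sphere of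 $\mathbb{C}^d\otimes\mathbb{C}^d$. Moreover, for all $t\ge0$, $\varepsilon\in(0,1)$, $\delta\in(0,1)$, with $$B=7\Big(1+\frac{\log(2/\delta)}{d}\Big)\frac{t^2}{\varepsilon},$$ the typical sample complexity for this $L$ satisfies $\overline{n}_d(t,\varepsilon,\delta)\le\lceil B\rceil$, and $\overline{n}_d(t,\varepsilon,\delta)\le B$ whenever $B\ge1$. In particular $\overline{n}_d(t,\varepsilon,\delta)=O(t^2/\varepsilon)$ with a constant independent of the dimension: for every $\delta\in(0,1)$ and every $C>7$ there is $D$ such that for all $d\ge\max(2,D)$, $t\ge0$ and $\varepsilon\in(0,1)$ one has $\overline{n}_d(t,\varepsilon,\delta)\le\lceil Ct^2/\varepsilon\rceil$, and $\overline{n}_d(t,\varepsilon,\delta)\le Ct^2/\varepsilon$ whenever $Ct^2/\varepsilon\ge1$. -/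

import Mathlib

open MeasureTheory
open scoped ENNReal Kronecker ComplexOrder

noncomputable section

namespace SampleSim

/-! ### Finite-dimensional quantum channels

Operators on a Hilbert space with orthonormal basis indexed by `m` are matrices indexed by `m`;
superoperators are linear maps between matrix spaces. -/

/-- Operators on the Hilbert space with orthonormal basis indexed by `m`. -/
abbrev Op (m : Type*) := Matrix m m ℂ

/-- The trace norm `‖X‖₁ = Tr[(X X†)^{1/2}]`: the sum of the square roots of the eigenvalues
of `X X†`. -/
def traceNorm {m : Type*} [Fintype m] [DecidableEq m] (X : Op m) : ℝ :=
  ∑ i, √((Matrix.isHermitian_mul_conjTranspose_self X).eigenvalues i)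

/-- The Schatten `2`-norm (Frobenius norm) `‖X‖₂ = (Tr[X X†])^{1/2} = (∑ |X i j|²)^{1/2}`. -/
def schattenTwoNorm {m : Type*} [Fintype m] (X : Op m) : ℝ :=
  √(∑ i, ∑ j, ‖X i j‖ ^ 2)

/-- Density operators: positive semidefinite operators of trace one. -/
def IsDensity {m : Type*} [Fintype m] (ρ : Op m) : Prop :=
  ρ.PosSemidef ∧ ρ.trace = 1

/-- The operator `(id_R ⊗ Φ)(X)`, where the reference system `R` has basis `r`: the map `Φ` is
applied to every block of `X`. -/
def ampliate {m n : Type*} (r : Type*) (Φ : Op m →ₗ[ℂ] Op n) (X : Op (r × m)) : Op (r × n) :=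
  Matrix.of fun p q => Φ (X.submatrix (Prod.mk p.1) (Prod.mk q.1)) p.2 q.2

/-- Completely positive and trace-preserving maps. -/
structure IsCPTP {m n : Type*} [Fintype m] [Fintype n] (Φ : Op m →ₗ[ℂ] Op n) : Prop where
  completelyPositive : ∀ (k : ℕ) (X : Op (Fin k × m)),
    X.PosSemidef → (ampliate (Fin k) Φ X).PosSemidef
  tracePreserving : ∀ X : Op m, (Φ X).trace = X.trace

/-- The diamond norm `‖Φ‖_⋄ = sup_ρ ‖(id_R ⊗ Φ)(ρ)‖₁`, over all reference systems `R` of finite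
dimension and all density operators `ρ` of the joint system. -/
def diamondNorm {m n : Type*} [Fintype m] [Fintype n] [DecidableEq n]
    (Φ : Op m →ₗ[ℂ] Op n) : ℝ≥0∞ :=
  ⨆ (k : ℕ) (ρ : Op (Fin k × m)) (_ : IsDensity ρ),
    ENNReal.ofReal (traceNorm (ampliate (Fin k) Φ ρ))

/-- The exponential `e^Φ` of a superoperator: the matrix exponential of its matrix in the
standard basis of the operator space. -/
def superExp {m : Type*} [Fintype m] [DecidableEq m] (Φ : Op m →ₗ[ℂ] Op m) : Op m →ₗ[ℂ] Op m :=
  (LinearMap.toMatrixAlgEquiv (Matrix.stdBasis ℂ m m)).symm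
    (NormedSpace.exp (LinearMap.toMatrixAlgEquiv (Matrix.stdBasis ℂ m m) Φ))

/-! ### Lindbladians and program states -/

/-- The Lindbladian with a single jump operator `L`:
`𝓛(ρ) = L ρ L† - ½ {L† L, ρ}`. -/
def lindbladian {m : Type*} [Fintype m] (L : Op m) : Op m →ₗ[ℂ] Op m where
  toFun ρ := L * ρ * L.conjTranspose
    - (1 / 2 : ℂ) • (L.conjTranspose * L * ρ + ρ * (L.conjTranspose * L))
  map_add' ρ σ := by
    simp only [mul_add, add_mul, smul_add]
    abel
  map_smul' c ρ := by
    simp only [Matrix.mul_smul, Matrix.smul_mul, RingHom.id_apply, smul_sub, smul_add,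
      smul_comm c (1 / 2 : ℂ)]

/-- The unnormalized maximally entangled vector `|Γ⟩ = ∑ i, |i⟩|i⟩`. -/
def maxEntangled (d : ℕ) : Fin d × Fin d → ℂ := fun p => if p.1 = p.2 then 1 else 0

/-- The vectorization `|L⟩ = (L ⊗ I)|Γ⟩`. -/
def programVector {d : ℕ} (L : Op (Fin d)) : Fin d × Fin d → ℂ :=
  (L ⊗ₖ (1 : Op (Fin d))).mulVec (maxEntangled d)

theorem programVector_apply {d : ℕ} (L : Op (Fin d)) (i j : Fin d) :
    programVector L (i, j) = L i j := by
  simp [programVector, maxEntangled, Matrix.mulVec, dotProduct, Fintype.sum_prod_type,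
    Matrix.one_apply]

/-- The pure program state `π_L = |L⟩⟨L|`, of dimension `d²`. -/
def programState {d : ℕ} (L : Op (Fin d)) : Op (Fin d × Fin d) :=
  Matrix.vecMulVec (programVector L) (star (programVector L))

/-- The appending map `ζ ↦ ζ ⊗ π^{⊗ n}`. -/
def appendCopies {m q : Type*} (n : ℕ) (π : Op q) : Op m →ₗ[ℂ] Op (m × (Fin n → q)) where
  toFun ζ := Matrix.of fun x y => ζ x.1 y.1 * ∏ k, π (x.2 k) (y.2 k)
  map_add' ζ ξ := by
    ext x y
    simp [add_mul]
  map_smul' c ζ := by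
    ext x y
    simp [mul_assoc]

/-! ### Random jump operators -/

/-- The standard complex Gaussian law on `ℂ`: mean zero and `E|z|² = 1`, with independent real and
imaginary parts of variance `1/2`. -/
def complexGaussian : Measure ℂ :=
  ((ProbabilityTheory.gaussianReal 0 (1 / 2)).prod
    (ProbabilityTheory.gaussianReal 0 (1 / 2))).map Complex.measurableEquivRealProd.symm

/-- The complex Ginibre ensemble: the law of the entries `G i j` of a random `d × d` matrix whose
entries are independent standard complex Gaussian variables. -/
def ginibre (d : ℕ) : Measure (Fin d → Fin d → ℂ) :=
  Measure.pi fun _ => Measure.pi fun _ => complexGaussian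

/-- The law of (the entries of) `L = G / ‖G‖₂`, for `G` a complex Ginibre matrix. -/
def normalizedGinibre (d : ℕ) : Measure (Fin d → Fin d → ℂ) :=
  (ginibre d).map fun G i j => G i j / (schattenTwoNorm (Matrix.of G) : ℂ)

/-- The law of (the entries of) `L` when `|L⟩ = ∑ L i j |i⟩|j⟩` is uniformly (Haar) distributed
on the unit sphere of `ℂ^d ⊗ ℂ^d`: the normalized surface measure. -/
def uniformProgram (d : ℕ) : Measure (Fin d → Fin d → ℂ) :=
  let σ := (volume : Measure (EuclideanSpace ℂ (Fin d × Fin d))).toSphere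
  ((σ Set.univ)⁻¹ • σ).map
    fun (ψ : Metric.sphere (0 : EuclideanSpace ℂ (Fin d × Fin d)) 1) i j =>
      (ψ : EuclideanSpace ℂ (Fin d × Fin d)) (i, j)

/-! ### Typical sample complexity -/

/-- The normalized diamond distance `½ ‖P ∘ A_{π_L^{⊗ n}} - e^{𝓛 t}‖_⋄` between the target channel
and its simulation by the map `P` that is given `n` copies of the program state. -/
def simulationError {d n : ℕ} (P : Op (Fin d × (Fin n → Fin d × Fin d)) →ₗ[ℂ] Op (Fin d))
    (L : Op (Fin d)) (t : ℝ) : ℝ≥0∞ :=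
  diamondNorm (P ∘ₗ appendCopies n (programState L) - superExp ((t : ℂ) • lindbladian L)) / 2

/-- The typical sample complexity when the jump operator `L` (equivalently, the program state) has
law `ν`: the least `n` for which one channel `P`, not depending on `L`, simulates `e^{𝓛 t}` from
`n` copies of `π_L` with error at most `ε`, with probability at least `1 - δ` over `L`.
It is `⊤` if there is no such `n`. -/
def typicalSampleComplexity {d : ℕ} (ν : Measure (Fin d → Fin d → ℂ)) (t ε δ : ℝ) : ℕ∞ :=
  ⨅ (n : ℕ) (_ : ∃ P : Op (Fin d × (Fin n → Fin d × Fin d)) →ₗ[ℂ] Op (Fin d), IsCPTP P ∧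
    ENNReal.ofReal (1 - δ) ≤ ν {L | simulationError P (Matrix.of L) t ≤ ENNReal.ofReal ε}),
    (n : ℕ∞)

end SampleSim

end

/-!
Write `K = ‖L‖²` for the squared operator norm of the jump operator, which is normalized in the
Frobenius norm.

*Simulation.* One step of the simulation measures the system and the second register of the
program in the projection onto the maximally entangled state, weakly with strength `c`, and keeps
the first register when the outcome occurs (`stepKraus`). On `ρ ⊗ π_L` this is `1 + s 𝓛_L` with
`s = (2 c - c²) / d` up to an error of order `c² K / d`. Iterating `n` times on fresh copies is a
single channel that does not depend on `L` (`exists_channel_pow`). Diamond norms are bounded by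
completely bounded norms in the Heisenberg picture, where channels are contractions, so the errors
of the steps add up, and the choice of `c` gives the normalized diamond error
`(d K / 2 + K²) t² / n` (`exists_channel_simulationError_le`). Contractivity of the Lindblad
semigroup itself follows from the same first-order expansion.

*Concentration.* A Ginibre matrix `G` has a rotation-invariant density, so its direction
`G / ‖G‖₂` is uniform on the sphere and independent of its norm
(`lintegral_normalized_mul_norm_ginibre`). Hence the moments of the operator norm of `L` are those
of `G` divided by those of `‖G‖₂`. For a Gaussian vector `b` one has
`k! ‖G‖ ^ (2 k) ≤ E ‖G b‖ ^ (2 k)`, because a component of `G b` in a maximal direction is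
Gaussian with variance `‖G‖²`; exchanging the integrals gives
`k! E ‖G‖ ^ (2 k) ≤ (d (d + 1) ⋯ (d + k - 1))²` (`lintegral_opNorm_ginibre_le`). Markov's
inequality with `k = 3 (d + ⌊log (2 / δ)⌋)` shows `d K ≤ 11 / 2 * (1 + ⌊log (2 / δ)⌋ / d)` with
probability at least `1 - δ` (`normalizedGinibre_tail`); together with `K ≤ 1` this yields
`d K / 2 + K² ≤ 7 / 2 * (1 + log (2 / δ) / d)` (`rate_le`).

*Rounding.* With this rate, `n ≥ B / 2` samples suffice, and `⌊B⌋ ≥ B / 2` as soon as `B ≥ 1`.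
-/

noncomputable section

namespace SampleSim

open scoped Matrix Matrix.Norms.L2Operator

/-! ### The operator norm and its duality with the trace norm -/

section OperatorNorm

variable {m n r ι : Type*} [Fintype m] [Fintype n] [Fintype r] [Fintype ι]
  [DecidableEq m] [DecidableEq n] [DecidableEq r] [DecidableEq ι]

omit [DecidableEq m] in
theorem l2_opNorm_le_of_forall {A : Matrix m n ℂ} {c : ℝ} (hc : 0 ≤ c)
    (h : ∀ x : n → ℂ, ∑ i, ‖(A *ᵥ x) i‖ ^ 2 ≤ c ^ 2 * ∑ j, ‖x j‖ ^ 2) : ‖A‖ ≤ c := by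
  rw [Matrix.l2_opNorm_def]
  refine ContinuousLinearMap.opNorm_le_bound _ hc fun x => ?_
  refine le_of_sq_le_sq ?_ (by positivity)
  rw [mul_pow, EuclideanSpace.norm_sq_eq, EuclideanSpace.norm_sq_eq]
  exact h x.ofLp

omit [DecidableEq m] in
theorem sum_norm_sq_mulVec_le (A : Matrix m n ℂ) (x : n → ℂ) :
    ∑ i, ‖(A *ᵥ x) i‖ ^ 2 ≤ ‖A‖ ^ 2 * ∑ j, ‖x j‖ ^ 2 := by
  have h := Matrix.l2_opNorm_mulVec A (WithLp.toLp 2 x)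
  have h2 := pow_le_pow_left₀ (norm_nonneg _) h 2
  rw [mul_pow, EuclideanSpace.norm_sq_eq, EuclideanSpace.norm_sq_eq] at h2
  exact h2

omit [DecidableEq m] in
/-- Tensoring with the identity of a reference system does not increase the operator norm. -/
theorem l2_opNorm_one_kronecker_le (A : Matrix m n ℂ) :
    ‖((1 : Matrix r r ℂ) ⊗ₖ A)‖ ≤ ‖A‖ := by
  refine l2_opNorm_le_of_forall (norm_nonneg _) fun x => ?_
  have key : ∀ a i, (((1 : Matrix r r ℂ) ⊗ₖ A) *ᵥ x) (a, i) = (A *ᵥ fun j => x (a, j)) i := by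
    intro a i
    simp [Matrix.mulVec, dotProduct, Fintype.sum_prod_type, Matrix.one_apply]
  rw [Fintype.sum_prod_type, Fintype.sum_prod_type, Finset.mul_sum]
  refine Finset.sum_le_sum fun a _ => ?_
  simp only [key]
  exact sum_norm_sq_mulVec_le A _

/-- A completely positive map in the Heisenberg picture attains its norm at the identity. -/
theorem norm_sum_conjTranspose_mul_mul_le (R : ι → Matrix n m ℂ) (U : Matrix n n ℂ) :
    ‖∑ a, (R a)ᴴ * U * R a‖ ≤ ‖∑ a, (R a)ᴴ * R a‖ * ‖U‖ := by
  -- Stack the operators into one column `V`, so that both sums become `V† (1 ⊗ ·) V`.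
  set V : Matrix (ι × n) m ℂ := Matrix.of fun p j => R p.1 p.2 j with hV
  have h1 : ∑ a, (R a)ᴴ * U * R a = Vᴴ * ((1 : Matrix ι ι ℂ) ⊗ₖ U) * V := by
    ext i j
    simp [hV, Matrix.mul_apply, Matrix.sum_apply, Fintype.sum_prod_type, Matrix.one_apply]
  have h2 : ∑ a, (R a)ᴴ * R a = Vᴴ * V := by
    ext i j
    simp [hV, Matrix.mul_apply, Matrix.sum_apply, Fintype.sum_prod_type]
  rw [h1, h2, Matrix.l2_opNorm_conjTranspose_mul_self]
  calc ‖Vᴴ * ((1 : Matrix ι ι ℂ) ⊗ₖ U) * V‖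
      ≤ ‖Vᴴ‖ * ‖((1 : Matrix ι ι ℂ) ⊗ₖ U)‖ * ‖V‖ :=
        (Matrix.l2_opNorm_mul _ _).trans (by gcongr; exact Matrix.l2_opNorm_mul _ _)
    _ ≤ ‖V‖ * ‖U‖ * ‖V‖ := by
        rw [Matrix.l2_opNorm_conjTranspose]
        gcongr
        exact l2_opNorm_one_kronecker_le U
    _ = ‖V‖ * ‖V‖ * ‖U‖ := by ring

theorem l2_opNorm_one_le : ‖(1 : Matrix n n ℂ)‖ ≤ 1 := by
  refine l2_opNorm_le_of_forall zero_le_one fun x => by simp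

omit [DecidableEq m] in
/-- The operator norm is at most the Frobenius norm. -/
theorem l2_opNorm_sq_le_sum (A : Matrix m n ℂ) : ‖A‖ ^ 2 ≤ ∑ i, ∑ j, ‖A i j‖ ^ 2 := by
  have h0 : 0 ≤ ∑ i, ∑ j, ‖A i j‖ ^ 2 := by positivity
  have : ‖A‖ ≤ √(∑ i, ∑ j, ‖A i j‖ ^ 2) := by
    refine l2_opNorm_le_of_forall (Real.sqrt_nonneg _) fun x => ?_
    rw [Real.sq_sqrt h0, Finset.sum_mul]
    refine Finset.sum_le_sum fun i _ => ?_
    calc ‖(A *ᵥ x) i‖ ^ 2 ≤ (∑ j, ‖A i j‖ * ‖x j‖) ^ 2 := by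
          gcongr
          refine (norm_sum_le _ _).trans (le_of_eq ?_)
          simp
      _ ≤ _ := Finset.sum_mul_sq_le_sq_mul_sq _ _ _
  calc ‖A‖ ^ 2 ≤ √(∑ i, ∑ j, ‖A i j‖ ^ 2) ^ 2 := by gcongr
    _ = _ := Real.sq_sqrt h0

/-- An operator has expectation at most its norm in every state. -/
theorem norm_trace_mul_le_of_isDensity {ρ : Op m} (hρ : IsDensity ρ) (V : Op m) :
    ‖(V * ρ).trace‖ ≤ ‖V‖ := by
  obtain ⟨hpos, htr⟩ := hρ
  obtain ⟨S, rfl⟩ : ∃ S : Op m, ρ = Sᴴ * S := by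
    open scoped MatrixOrder in
    exact CStarAlgebra.nonneg_iff_eq_star_mul_self.mp hpos.nonneg
  -- `tr (V S† S) = tr (S V S†)` is a sum over the rows `s` of `S` of `⟨s, V s⟩`.
  have hrow : ∀ (W : Op m), (W * (Sᴴ * S)).trace = ∑ i, star (fun j => star (S i j)) ⬝ᵥ
      (W *ᵥ fun j => star (S i j)) := by
    intro W
    rw [← Matrix.mul_assoc, Matrix.trace_mul_comm, Matrix.trace]
    refine Finset.sum_congr rfl fun i _ => ?_
    simp [Matrix.mul_apply, Matrix.mulVec, dotProduct]
  have hone : ∑ i, ∑ j, ‖S i j‖ ^ 2 = 1 := by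
    have := hrow 1
    rw [Matrix.one_mul, htr] at this
    apply Complex.ofReal_injective
    rw [Complex.ofReal_one, this]
    push_cast
    refine Finset.sum_congr rfl fun i _ => ?_
    simp [dotProduct, Complex.mul_conj']
  rw [hrow]
  calc ‖∑ i, star (fun j => star (S i j)) ⬝ᵥ (V *ᵥ fun j => star (S i j))‖
      ≤ ∑ i, ‖V‖ * ∑ j, ‖S i j‖ ^ 2 := by
        refine (norm_sum_le _ _).trans (Finset.sum_le_sum fun i _ => ?_)
        set x : m → ℂ := fun j => star (S i j)
        have hx : ∑ j, ‖S i j‖ ^ 2 = ∑ j, ‖x j‖ ^ 2 := by simp [x]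
        rw [hx]
        have h1 := sum_norm_sq_mulVec_le V x
        refine le_of_sq_le_sq ?_ (by positivity)
        calc ‖star x ⬝ᵥ (V *ᵥ x)‖ ^ 2 ≤ (∑ j, ‖x j‖ * ‖(V *ᵥ x) j‖) ^ 2 := by
              gcongr
              refine (norm_sum_le _ _).trans (le_of_eq ?_)
              simp
          _ ≤ (∑ j, ‖x j‖ ^ 2) * ∑ j, ‖(V *ᵥ x) j‖ ^ 2 := Finset.sum_mul_sq_le_sq_mul_sq _ _ _
          _ ≤ (∑ j, ‖x j‖ ^ 2) * (‖V‖ ^ 2 * ∑ j, ‖x j‖ ^ 2) := by gcongr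
          _ = _ := by ring
    _ = ‖V‖ := by rw [← Finset.mul_sum, hone, mul_one]

theorem inv_sqrt_mul_self_mul_inv_sqrt {x : ℝ} (hx : 0 < x) : (√x)⁻¹ * x * (√x)⁻¹ = 1 := by
  have h : √x ≠ 0 := (Real.sqrt_pos.2 hx).ne'
  field_simp
  rw [Real.sq_sqrt hx.le]

/-- The trace norm is attained by pairing with a contraction (a polar part of `X`). -/
theorem exists_contraction_trace_eq_traceNorm (X : Op m) :
    ∃ U : Op m, ‖U‖ ≤ 1 ∧ (U * X).trace = traceNorm X := by
  obtain ⟨W, e, hWW, he, hspec, htn⟩ : ∃ (W : Op m) (e : m → ℝ), Wᴴ * W = 1 ∧ (∀ i, 0 ≤ e i) ∧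
      X * Xᴴ = W * Matrix.diagonal (fun i => (e i : ℂ)) * Wᴴ ∧ traceNorm X = ∑ i, √(e i) := by
    have hX := Matrix.isHermitian_mul_conjTranspose_self X
    refine ⟨(hX.eigenvectorUnitary : Matrix m m ℂ), hX.eigenvalues, ?_,
      (Matrix.posSemidef_self_mul_conjTranspose X).eigenvalues_nonneg, ?_, rfl⟩
    · simpa [Matrix.star_eq_conjTranspose] using Unitary.coe_star_mul_self hX.eigenvectorUnitary
    · have := hX.spectral_theorem
      rw [Unitary.conjStarAlgAut_apply] at this
      simpa [Matrix.star_eq_conjTranspose, Function.comp_def] using this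
  -- The contraction is `X† (X X†)^{-1/2}`, with the inverse taken on the support of `X X†`.
  set D : Op m := Matrix.diagonal (fun i => (((√(e i))⁻¹ : ℝ) : ℂ)) with hD
  set Λ : Op m := Matrix.diagonal (fun i => (e i : ℂ)) with hΛ
  have hDH : Dᴴ = D := by
    rw [hD, Matrix.diagonal_conjTranspose]
    congr 1
    ext i
    simp
  have hcancel : ∀ Y Z : Op m, W * Y * Wᴴ * (W * Z * Wᴴ) = W * (Y * Z) * Wᴴ := by
    intro Y Z
    calc W * Y * Wᴴ * (W * Z * Wᴴ) = W * Y * (Wᴴ * W) * Z * Wᴴ := by simp only [Matrix.mul_assoc]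
      _ = _ := by rw [hWW]; simp only [Matrix.mul_assoc, Matrix.mul_one]
  have hnorm : ‖D * Λ * D‖ ≤ 1 := by
    rw [hD, hΛ, Matrix.diagonal_mul_diagonal, Matrix.diagonal_mul_diagonal,
      Matrix.l2_opNorm_diagonal]
    refine (pi_norm_le_iff_of_nonneg zero_le_one).2 fun i => ?_
    rw [← Complex.ofReal_mul, ← Complex.ofReal_mul, Complex.norm_real, Real.norm_eq_abs]
    rcases (he i).eq_or_lt with h | h
    · simp [← h]
    · rw [inv_sqrt_mul_self_mul_inv_sqrt h, abs_one]
  have hW1 : ‖W‖ ≤ 1 := by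
    have := Matrix.l2_opNorm_conjTranspose_mul_self W
    rw [hWW] at this
    nlinarith [norm_nonneg W, l2_opNorm_one_le (n := m)]
  have hconj : ‖W * (D * Λ * D) * Wᴴ‖ ≤ 1 := by
    calc ‖W * (D * Λ * D) * Wᴴ‖ ≤ ‖W‖ * ‖D * Λ * D‖ * ‖W‖ := by
          refine (Matrix.l2_opNorm_mul _ _).trans ?_
          rw [Matrix.l2_opNorm_conjTranspose]
          gcongr
          exact Matrix.l2_opNorm_mul _ _
      _ ≤ 1 * 1 * 1 := by gcongr
      _ = 1 := by norm_num
  refine ⟨Xᴴ * (W * D * Wᴴ), ?_, ?_⟩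
  · have h1 : (Xᴴ * (W * D * Wᴴ))ᴴ * (Xᴴ * (W * D * Wᴴ)) = W * (D * Λ * D) * Wᴴ := by
      have : (Xᴴ * (W * D * Wᴴ))ᴴ * (Xᴴ * (W * D * Wᴴ)) =
          W * D * Wᴴ * (X * Xᴴ) * (W * D * Wᴴ) := by
        simp only [Matrix.conjTranspose_mul, Matrix.conjTranspose_conjTranspose, hDH]
        simp only [Matrix.mul_assoc]
      rw [this, hspec, hcancel, hcancel]
    have h2 := Matrix.l2_opNorm_conjTranspose_mul_self (Xᴴ * (W * D * Wᴴ))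
    rw [h1] at h2
    nlinarith [norm_nonneg (Xᴴ * (W * D * Wᴴ))]
  · rw [Matrix.mul_assoc, Matrix.trace_mul_comm, Matrix.mul_assoc, hspec, hcancel,
      Matrix.trace_mul_comm, ← Matrix.mul_assoc, hWW, Matrix.one_mul, hD, hΛ,
      Matrix.diagonal_mul_diagonal, Matrix.trace_diagonal, htn]
    push_cast
    refine Finset.sum_congr rfl fun i _ => ?_
    rw [← Complex.ofReal_inv, ← Complex.ofReal_mul]
    congr 1
    rw [inv_mul_eq_div, Real.div_sqrt]

end OperatorNorm

/-! ### Contraction semigroups in a normed algebra -/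

section ContractionSemigroup

open NormedSpace

variable {𝔸 : Type*} [NormedRing 𝔸] [NormedAlgebra ℝ 𝔸] [NormedAlgebra ℚ 𝔸] [CompleteSpace 𝔸]

/-- A semigroup is contractive if its first-order approximations `1 + s A` are, up to `o(s)`. -/
theorem norm_exp_smul_le_one (h1 : ‖(1 : 𝔸)‖ ≤ 1) {A : 𝔸}
    (hA : ∀ η > 0, ∃ s₀ > 0, ∀ s : ℝ, 0 < s → s < s₀ → ‖1 + s • A‖ ≤ 1 + η * s)
    {t : ℝ} (ht : 0 ≤ t) : ‖exp (t • A)‖ ≤ 1 := by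
  have key : ∀ η > 0, ‖exp (t • A)‖ ≤ Real.exp (2 * η * t) := by
    intro η hη
    rcases ht.eq_or_lt with rfl | ht
    · simpa using h1
    obtain ⟨s₀, hs₀, hs⟩ := hA η hη
    have hd : HasDerivAt (fun s : ℝ => exp (s • A)) A 0 := by
      simpa using hasDerivAt_exp_smul_const (𝕂 := ℝ) A (0 : ℝ)
    have ho := (hasDerivAt_iff_isLittleO_nhds_zero.1 hd).def hη
    obtain ⟨s₁, hs₁, hs'⟩ := Metric.eventually_nhds_iff.1 ho
    obtain ⟨N, hN⟩ := exists_nat_gt (t / min s₀ s₁)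
    have hmin : 0 < min s₀ s₁ := lt_min hs₀ hs₁
    have hN0 : (0 : ℝ) < N := lt_of_le_of_lt (by positivity) hN
    set s : ℝ := t / N with hsdef
    have hspos : 0 < s := by positivity
    have hsmin : s < min s₀ s₁ := by
      rw [hsdef, div_lt_iff₀ hN0]
      rwa [div_lt_iff₀ hmin, mul_comm] at hN
    have hstep : ‖exp (s • A)‖ ≤ 1 + 2 * η * s := by
      have e1 := hs s hspos (hsmin.trans_le (min_le_left _ _))
      have e2 := hs' (y := s) (by
        rw [Real.dist_eq, sub_zero, abs_of_pos hspos]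
        exact hsmin.trans_le (min_le_right _ _))
      simp only [zero_add, zero_smul, exp_zero, Real.norm_eq_abs, abs_of_pos hspos] at e2
      calc ‖exp (s • A)‖ = ‖(1 + s • A) + (exp (s • A) - 1 - s • A)‖ := by congr 1; abel
        _ ≤ ‖1 + s • A‖ + ‖exp (s • A) - 1 - s • A‖ := norm_add_le _ _
        _ ≤ (1 + η * s) + η * s := add_le_add e1 e2
        _ = _ := by ring
    have hpow : exp (t • A) = exp (s • A) ^ N := by
      rw [← exp_nsmul, ← Nat.cast_smul_eq_nsmul ℝ, smul_smul, hsdef, mul_div_cancel₀ _ hN0.ne']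
    have hNpos : 0 < N := by exact_mod_cast hN0
    calc ‖exp (t • A)‖ ≤ ‖exp (s • A)‖ ^ N := by rw [hpow]; exact norm_pow_le' _ hNpos
      _ ≤ (1 + 2 * η * s) ^ N := by gcongr
      _ ≤ Real.exp (2 * η * s) ^ N := by
          gcongr
          linarith [Real.add_one_le_exp (2 * η * s)]
      _ = Real.exp (2 * η * t) := by
          rw [← Real.exp_nat_mul, hsdef]
          congr 1
          field_simp
  have hlim : Filter.Tendsto (fun η : ℝ => Real.exp (2 * η * t)) (nhdsWithin 0 (Set.Ioi 0))
      (nhds 1) := by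
    have : Continuous fun η : ℝ => Real.exp (2 * η * t) := by fun_prop
    have h := this.tendsto 0
    simp only [mul_zero, zero_mul, Real.exp_zero] at h
    exact h.mono_left nhdsWithin_le_nhds
  exact ge_of_tendsto hlim (eventually_mem_nhdsWithin.mono fun η hη => key η hη)

variable {A : 𝔸} (hA : ∀ s : ℝ, 0 ≤ s → ‖exp (s • A)‖ ≤ 1)
include hA

omit [NormedAlgebra ℚ 𝔸] in
theorem norm_exp_smul_sub_one_le {t : ℝ} (ht : 0 ≤ t) : ‖exp (t • A) - 1‖ ≤ ‖A‖ * t := by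
  have := norm_image_sub_le_of_norm_deriv_le_segment' (f := fun s : ℝ => exp (s • A))
    (f' := fun s => exp (s • A) * A) (a := 0) (b := t) (C := ‖A‖)
    (fun s _ => (hasDerivAt_exp_smul_const (𝕂 := ℝ) A s).hasDerivWithinAt)
    (fun s hs => (norm_mul_le _ _).trans
      (mul_le_of_le_one_left (norm_nonneg _) (hA s hs.1))) t ⟨ht, le_rfl⟩
  simpa using this

omit [NormedAlgebra ℚ 𝔸] in
theorem norm_exp_smul_sub_one_sub_le {t : ℝ} (ht : 0 ≤ t) :
    ‖exp (t • A) - 1 - t • A‖ ≤ ‖A‖ ^ 2 * t ^ 2 / 2 := by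
  have hder : ∀ s : ℝ, HasDerivAt (fun s : ℝ => exp (s • A) - 1 - s • A)
      (exp (s • A) * A - A) s := by
    intro s
    have := ((hasDerivAt_exp_smul_const (𝕂 := ℝ) A s).sub_const 1).sub
      ((hasDerivAt_id s).smul_const A)
    exact this.congr_deriv (by simp)
  refine image_norm_le_of_norm_deriv_right_le_deriv_boundary
    (f := fun s : ℝ => exp (s • A) - 1 - s • A) (f' := fun s => exp (s • A) * A - A)
    (a := 0) (b := t) (B := fun s => ‖A‖ ^ 2 * s ^ 2 / 2) (B' := fun s => ‖A‖ ^ 2 * s)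
    (fun s _ => (hder s).continuousAt.continuousWithinAt)
    (fun s _ => (hder s).hasDerivWithinAt) (by simp) ?_ ?_ ⟨ht, le_rfl⟩
  · intro s
    have := (((hasDerivAt_id s).pow 2).const_mul (‖A‖ ^ 2)).div_const 2
    refine this.congr_deriv ?_
    simp
    ring
  · intro s hs
    have : exp (s • A) * A - A = (exp (s • A) - 1) * A := by rw [sub_mul, one_mul]
    rw [this]
    calc ‖(exp (s • A) - 1) * A‖ ≤ ‖exp (s • A) - 1‖ * ‖A‖ := norm_mul_le _ _
      _ ≤ (‖A‖ * s) * ‖A‖ := by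
          gcongr
          exact norm_exp_smul_sub_one_le hA hs.1
      _ = _ := by ring

theorem norm_exp_smul_sub_exp_smul_le {r t : ℝ} (hr : 0 ≤ r) (hrt : r ≤ t) :
    ‖exp (t • A) - exp (r • A)‖ ≤ ‖A‖ * (t - r) := by
  have h : exp (t • A) - exp (r • A) = exp (r • A) * (exp ((t - r) • A) - 1) := by
    rw [mul_sub, mul_one, ← exp_add_of_commute (((Commute.refl A).smul_left r).smul_right (t - r)),
      ← add_smul, add_sub_cancel]
  rw [h]
  calc ‖exp (r • A) * (exp ((t - r) • A) - 1)‖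
      ≤ ‖exp (r • A)‖ * ‖exp ((t - r) • A) - 1‖ := norm_mul_le _ _
    _ ≤ 1 * (‖A‖ * (t - r)) := by
        gcongr
        · exact hA r hr
        · exact norm_exp_smul_sub_one_le hA (sub_nonneg.2 hrt)
    _ = _ := one_mul _

omit hA [NormedAlgebra ℝ 𝔸] [NormedAlgebra ℚ 𝔸] [CompleteSpace 𝔸] in
/-- Powers of contractions are at distance at most `n` times the distance of the contractions. -/
theorem norm_pow_sub_pow_le_mul (h1 : ‖(1 : 𝔸)‖ ≤ 1) {E F : 𝔸} (hE : ‖E‖ ≤ 1) (hF : ‖F‖ ≤ 1)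
    (n : ℕ) : ‖E ^ n - F ^ n‖ ≤ n * ‖E - F‖ := by
  have hpow : ∀ k : ℕ, ‖F ^ k‖ ≤ 1 := by
    intro k
    rcases Nat.eq_zero_or_pos k with rfl | hk
    · simpa using h1
    · exact (norm_pow_le' F hk).trans (pow_le_one₀ (norm_nonneg _) hF)
  induction n with
  | zero => simp
  | succ n ih =>
    have h : E ^ (n + 1) - F ^ (n + 1) = E * (E ^ n - F ^ n) + (E - F) * F ^ n := by
      rw [pow_succ', pow_succ']
      noncomm_ring
    rw [h]
    calc ‖E * (E ^ n - F ^ n) + (E - F) * F ^ n‖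
        ≤ ‖E‖ * ‖E ^ n - F ^ n‖ + ‖E - F‖ * ‖F ^ n‖ :=
          (norm_add_le _ _).trans (add_le_add (norm_mul_le _ _) (norm_mul_le _ _))
      _ ≤ 1 * (n * ‖E - F‖) + ‖E - F‖ * 1 := by
          gcongr
          exact hpow n
      _ = _ := by push_cast; ring

/-- A contraction `E` close to `1 + r A` stays, after `n` steps, close to the contraction semigroup
`exp (t A)`, for every time `t ≥ n r`. -/
theorem norm_pow_sub_exp_le (h1 : ‖(1 : 𝔸)‖ ≤ 1) {E : 𝔸} (hE : ‖E‖ ≤ 1) {n : ℕ} (hn : 0 < n)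
    {r t : ℝ} (hr : 0 ≤ r) (hrt : r ≤ t / n) :
    ‖E ^ n - exp (t • A)‖ ≤
      n * (‖E - 1 - r • A‖ + ‖A‖ * (t / n - r) + ‖A‖ ^ 2 * r ^ 2 / 2) := by
  have hn' : (n : ℝ) ≠ 0 := by positivity
  have hpow : exp (t • A) = exp ((t / n) • A) ^ n := by
    rw [← exp_nsmul, ← Nat.cast_smul_eq_nsmul ℝ, smul_smul, mul_div_cancel₀ _ hn']
  rw [hpow]
  refine (norm_pow_sub_pow_le_mul h1 hE (hA _ (hr.trans hrt)) n).trans ?_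
  gcongr
  have e1 := norm_exp_smul_sub_exp_smul_le hA hr hrt
  have e2 := norm_exp_smul_sub_one_sub_le hA hr
  have h : E - exp ((t / n) • A) = (E - 1 - r • A) - (exp ((t / n) • A) - exp (r • A))
      - (exp (r • A) - 1 - r • A) := by abel
  rw [h]
  refine (norm_sub_le _ _).trans (add_le_add ((norm_sub_le _ _).trans (add_le_add le_rfl e1)) e2)

end ContractionSemigroup

/-! ### Superoperators in the Heisenberg picture -/

section Heisenberg

variable {m r : Type*} [Fintype m] [Fintype r] [DecidableEq m] [DecidableEq r]

/-- The adjoint of a superoperator for the bilinear trace pairing `(U, X) ↦ tr (U X)`: the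
superoperator in the Heisenberg picture. -/
def traceDual (Φ : Op m →ₗ[ℂ] Op m) : Op m →ₗ[ℂ] Op m where
  toFun U := Matrix.of fun i j => (U * Φ (Matrix.single j i 1)).trace
  map_add' U V := by ext i j; simp [add_mul]
  map_smul' c U := by ext i j; simp

theorem trace_traceDual_mul (Φ : Op m →ₗ[ℂ] Op m) (U X : Op m) :
    (traceDual Φ U * X).trace = (U * Φ X).trace := by
  have hX : X = ∑ i, ∑ j, X i j • Matrix.single i j (1 : ℂ) := by
    conv_lhs => rw [Matrix.matrix_eq_sum_single X]
    simp [Matrix.smul_single]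
  conv_rhs => rw [hX]
  simp only [map_sum, map_smul, Finset.mul_sum, Matrix.mul_smul, Matrix.trace_sum,
    Matrix.trace_smul]
  rw [Matrix.trace, Finset.sum_comm]
  refine Finset.sum_congr rfl fun i _ => ?_
  rw [Matrix.diag_apply, Matrix.mul_apply]
  refine Finset.sum_congr rfl fun j _ => ?_
  simp [traceDual, mul_comm]

omit [DecidableEq m] in
theorem eq_of_trace_mul_eq {A B : Op m} (h : ∀ X : Op m, (A * X).trace = (B * X).trace) :
    A = B := Matrix.ext_iff_trace_mul_right.2 h

theorem traceDual_eq_of_trace {Φ : Op m →ₗ[ℂ] Op m} {U V : Op m}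
    (h : ∀ X, (V * X).trace = (U * Φ X).trace) : traceDual Φ U = V :=
  eq_of_trace_mul_eq fun X => by rw [trace_traceDual_mul, h]

/-- The Heisenberg picture of `id_R ⊗ Φ`, as a bounded operator for the operator norm. It reverses
the order of products. -/
def heisenberg (r : Type*) [Fintype r] [DecidableEq r] :
    (Op m →ₗ[ℂ] Op m) →ₗ[ℂ] (Op (r × m) →L[ℂ] Op (r × m)) where
  toFun Φ := LinearMap.toContinuousLinearMap (traceDual
    { toFun := ampliate r Φ
      map_add' := fun X Y => by
        ext p q
        simp only [ampliate, Matrix.of_apply, Matrix.add_apply]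
        rw [← Matrix.add_apply, ← map_add]
        rfl
      map_smul' := fun c X => by
        ext p q
        simp only [ampliate, Matrix.of_apply, Matrix.smul_apply, RingHom.id_apply]
        rw [← Matrix.smul_apply, ← map_smul]
        rfl })
  map_add' Φ Ψ := by
    ext1 U
    refine traceDual_eq_of_trace fun X => ?_
    simp only [add_apply, LinearMap.coe_toContinuousLinearMap', add_mul,
      Matrix.trace_add, trace_traceDual_mul]
    rw [← Matrix.trace_add, ← Matrix.mul_add]
    rfl
  map_smul' c Φ := by
    ext1 U
    refine traceDual_eq_of_trace fun X => ?_
    simp only [smul_apply, LinearMap.coe_toContinuousLinearMap',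
      Matrix.smul_mul, Matrix.trace_smul, trace_traceDual_mul, RingHom.id_apply]
    rw [← Matrix.trace_smul, ← Matrix.mul_smul]
    rfl

theorem trace_heisenberg_mul (Φ : Op m →ₗ[ℂ] Op m) (U X : Op (r × m)) :
    (heisenberg r Φ U * X).trace = (U * ampliate r Φ X).trace :=
  trace_traceDual_mul _ _ _

theorem heisenberg_eq_of_trace {Φ : Op m →ₗ[ℂ] Op m} {U V : Op (r × m)}
    (h : ∀ X, (V * X).trace = (U * ampliate r Φ X).trace) : heisenberg r Φ U = V :=
  eq_of_trace_mul_eq fun X => by rw [trace_heisenberg_mul, h]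

theorem heisenberg_one : heisenberg r (1 : Op m →ₗ[ℂ] Op m) = 1 := by
  ext1 U
  exact heisenberg_eq_of_trace fun X => rfl

theorem heisenberg_mul (Φ Ψ : Op m →ₗ[ℂ] Op m) :
    heisenberg r (Φ * Ψ) = heisenberg r Ψ * heisenberg r Φ := by
  ext1 U
  refine heisenberg_eq_of_trace fun X => ?_
  rw [mul_apply_eq_comp, trace_heisenberg_mul, trace_heisenberg_mul]
  rfl

theorem heisenberg_pow (Φ : Op m →ₗ[ℂ] Op m) (n : ℕ) :
    heisenberg r (Φ ^ n) = heisenberg r Φ ^ n := by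
  induction n with
  | zero => exact heisenberg_one
  | succ n ih => rw [pow_succ, heisenberg_mul, ih, pow_succ']

/-- The Heisenberg picture commutes with exponentials: it reverses products, but preserves
powers. -/
theorem heisenberg_superExp (Φ : Op m →ₗ[ℂ] Op m) :
    heisenberg r (superExp Φ) = NormedSpace.exp (heisenberg r Φ) := by
  set e := LinearMap.toMatrixAlgEquiv (Matrix.stdBasis ℂ m m) with he
  have h := NormedSpace.exp_series_hasSum_exp' (𝕂 := ℂ) (e Φ)
  -- On the finite-dimensional space of superoperators every linear map is continuous.
  let T : Matrix (m × m) (m × m) ℂ →L[ℂ] (Op (r × m) →L[ℂ] Op (r × m)) :=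
    LinearMap.toContinuousLinearMap (heisenberg r ∘ₗ e.symm.toLinearMap)
  have h2 := h.mapL T
  have h3 : ∀ n : ℕ, T ((n.factorial⁻¹ : ℂ) • e Φ ^ n) =
      (n.factorial⁻¹ : ℂ) • heisenberg r Φ ^ n := by
    intro n
    rw [map_smul, ← heisenberg_pow]
    congr 1
    change heisenberg r (e.symm (e Φ ^ n)) = _
    rw [map_pow, AlgEquiv.symm_apply_apply]
  simp only [h3] at h2
  exact h2.unique (NormedSpace.exp_series_hasSum_exp' (𝕂 := ℂ) (heisenberg r Φ))

/-- The diamond norm is at most the completely bounded operator norm of the map in the Heisenberg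
picture. -/
theorem diamondNorm_le_of_heisenberg {Φ : Op m →ₗ[ℂ] Op m} {c : ℝ}
    (h : ∀ k : ℕ, ‖heisenberg (Fin k) Φ‖ ≤ c) : diamondNorm Φ ≤ ENNReal.ofReal c := by
  refine iSup_le fun k => iSup_le fun ρ => iSup_le fun hρ => ENNReal.ofReal_le_ofReal ?_
  obtain ⟨U, hU, hUX⟩ := exists_contraction_trace_eq_traceNorm (ampliate (Fin k) Φ ρ)
  rw [← trace_heisenberg_mul] at hUX
  calc traceNorm (ampliate (Fin k) Φ ρ) ≤ ‖((traceNorm (ampliate (Fin k) Φ ρ) : ℝ) : ℂ)‖ := by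
        rw [Complex.norm_real]
        exact Real.le_norm_self _
    _ = ‖(heisenberg (Fin k) Φ U * ρ).trace‖ := by rw [hUX]
    _ ≤ ‖heisenberg (Fin k) Φ U‖ := norm_trace_mul_le_of_isDensity hρ _
    _ ≤ ‖heisenberg (Fin k) Φ‖ * ‖U‖ := ContinuousLinearMap.le_opNorm _ _
    _ ≤ c * 1 := mul_le_mul (h k) hU (norm_nonneg _) ((norm_nonneg _).trans (h k))
    _ = c := mul_one c

end Heisenberg

/-! ### Kraus maps -/

section Kraus

variable {ι m n q r : Type*} [Fintype ι] [Fintype m] [Fintype r] [DecidableEq r]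

/-- The map `X ↦ ∑ a, A a X (A a)†` with Kraus operators `A`. -/
def krausMap (A : ι → Matrix n m ℂ) : Op m →ₗ[ℂ] Op n where
  toFun X := ∑ a, A a * X * (A a)ᴴ
  map_add' X Y := by simp [Matrix.mul_add, Matrix.add_mul, Finset.sum_add_distrib]
  map_smul' c X := by simp [Finset.smul_sum]

theorem krausMap_apply (A : ι → Matrix n m ℂ) (X : Op m) :
    krausMap A X = ∑ a, A a * X * (A a)ᴴ := rfl

theorem block_mul_mul (B : Matrix n m ℂ) (C : Matrix m n ℂ) (X : Op (r × m)) :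
    (Matrix.of fun p q => (B * X.submatrix (Prod.mk p.1) (Prod.mk q.1) * C) p.2 q.2 :
      Op (r × n)) = ((1 : Op r) ⊗ₖ B) * X * ((1 : Op r) ⊗ₖ C) := by
  ext ⟨a, i⟩ ⟨b, j⟩
  simp [Matrix.mul_apply, Fintype.sum_prod_type, Matrix.one_apply]

omit [Fintype m] [Fintype r] in
theorem one_kronecker_conjTranspose (B : Matrix n m ℂ) :
    ((1 : Op r) ⊗ₖ B)ᴴ = (1 : Op r) ⊗ₖ Bᴴ := by
  rw [Matrix.conjTranspose_kronecker, Matrix.conjTranspose_one]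

theorem ampliate_krausMap (A : ι → Matrix n m ℂ) (X : Op (r × m)) :
    ampliate r (krausMap A) X = krausMap (fun a => (1 : Op r) ⊗ₖ A a) X := by
  rw [krausMap_apply]
  simp only [one_kronecker_conjTranspose, ← block_mul_mul]
  ext p q
  simp [ampliate, krausMap_apply, Matrix.sum_apply]

theorem isCPTP_krausMap [Fintype n] [DecidableEq m] {A : ι → Matrix n m ℂ}
    (hA : ∑ a, (A a)ᴴ * A a = 1) :
    IsCPTP (krausMap A) where
  completelyPositive k X hX := by
    rw [ampliate_krausMap, krausMap_apply]
    exact Matrix.posSemidef_sum _ fun a _ => hX.mul_mul_conjTranspose_same _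
  tracePreserving X := by
    rw [krausMap_apply, Matrix.trace_sum]
    simp_rw [fun a => Matrix.trace_mul_comm (A a * X) (A a)ᴴ, ← Matrix.mul_assoc]
    rw [← Matrix.trace_sum, ← Finset.sum_mul, hA, one_mul]

theorem heisenberg_krausMap [DecidableEq m] (A : ι → Op m) (U : Op (r × m)) :
    heisenberg r (krausMap A) U =
      ∑ a, ((1 : Op r) ⊗ₖ A a)ᴴ * U * ((1 : Op r) ⊗ₖ A a) := by
  refine heisenberg_eq_of_trace fun X => ?_
  rw [ampliate_krausMap, krausMap_apply, Finset.sum_mul, Finset.mul_sum, Matrix.trace_sum,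
    Matrix.trace_sum]
  refine Finset.sum_congr rfl fun a _ => ?_
  rw [Matrix.mul_assoc, Matrix.mul_assoc, Matrix.trace_mul_comm]
  simp only [Matrix.mul_assoc]

/-- In the Heisenberg picture channels are contractions: they are positive and unital. -/
theorem norm_heisenberg_krausMap_le_one [DecidableEq m] {A : ι → Op m}
    (hA : ∑ a, (A a)ᴴ * A a = 1) :
    ‖heisenberg r (krausMap A)‖ ≤ 1 := by
  classical
  refine ContinuousLinearMap.opNorm_le_bound _ zero_le_one fun U => ?_
  rw [heisenberg_krausMap]
  refine (norm_sum_conjTranspose_mul_mul_le _ _).trans ?_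
  gcongr
  have h : ∑ a, ((1 : Op r) ⊗ₖ A a)ᴴ * ((1 : Op r) ⊗ₖ A a) = 1 := by
    have h1 : ∀ a, ((1 : Op r) ⊗ₖ A a)ᴴ * ((1 : Op r) ⊗ₖ A a) = (1 : Op r) ⊗ₖ ((A a)ᴴ * A a) := by
      intro a
      rw [Matrix.conjTranspose_kronecker, ← Matrix.mul_kronecker_mul, Matrix.conjTranspose_one,
        Matrix.one_mul]
    simp only [h1]
    ext ⟨a, i⟩ ⟨b, j⟩
    have := congrFun (congrFun hA i) j
    rw [Matrix.sum_apply] at this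
    simp only [Matrix.sum_apply, Matrix.kroneckerMap_apply, ← Finset.mul_sum, this]
    by_cases h : a = b <;> simp [Matrix.one_apply, h]
  rw [h]
  exact l2_opNorm_one_le

end Kraus

/-! ### Iterating a programmable channel -/

section Programmed

variable {ι κ m q : Type*} [Fintype ι] [Fintype κ] [Fintype m] [Fintype q]

/-- The Kraus operators that remain when the program register of `A` is put in the vector `v`. -/
def programmed (A : ι → Matrix m (m × q) ℂ) (v : q → ℂ) : ι → Op m :=
  fun a => Matrix.of fun i j => ∑ x, A a i (j, x) * v x

/-- Run `B` on the last `n` program copies and then `A` on the first one. -/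
def consKraus {n : ℕ} (A : ι → Matrix m (m × q) ℂ) (B : κ → Matrix m (m × (Fin n → q)) ℂ) :
    ι × κ → Matrix m (m × (Fin (n + 1) → q)) ℂ :=
  fun p => Matrix.of fun i x => ∑ l, A p.1 i (l, x.2 0) * B p.2 l (x.1, Fin.tail x.2)

theorem krausMap_comp_appendCopies [DecidableEq m] {n : ℕ}
    (B : κ → Matrix m (m × (Fin n → q)) ℂ) (v : q → ℂ) :
    krausMap B ∘ₗ appendCopies n (Matrix.vecMulVec v (star v)) =
      krausMap (programmed B fun f => ∏ k, v (f k)) := by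
  -- `ζ ⊗ π^{⊗ n} = V ζ V†` for the isometry `V` that appends the product vector.
  set V : Matrix (m × (Fin n → q)) m ℂ :=
    Matrix.of fun x j => if x.1 = j then ∏ k, v (x.2 k) else 0 with hV
  have h1 : ∀ ζ : Op m,
      appendCopies n (Matrix.vecMulVec v (star v)) ζ = V * ζ * V.conjTranspose := by
    intro ζ
    ext x y
    simp [hV, appendCopies, Matrix.mul_apply, Matrix.vecMulVec_apply, Finset.prod_mul_distrib,
      apply_ite (starRingEnd ℂ)]
    ring
  have h2 : ∀ b, programmed B (fun f => ∏ k, v (f k)) b = B b * V := by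
    intro b
    ext i j
    simp [hV, programmed, Matrix.mul_apply, Fintype.sum_prod_type_right]
  ext1 ζ
  simp only [LinearMap.comp_apply, krausMap_apply, h1, h2, Matrix.conjTranspose_mul,
    Matrix.mul_assoc]

omit [Fintype ι] [Fintype κ] in
theorem programmed_consKraus {n : ℕ} (A : ι → Matrix m (m × q) ℂ)
    (B : κ → Matrix m (m × (Fin n → q)) ℂ) (v : q → ℂ) (p : ι × κ) :
    programmed (consKraus A B) (fun f => ∏ k, v (f k)) p =
      programmed A v p.1 * programmed B (fun f => ∏ k, v (f k)) p.2 := by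
  ext i j
  simp only [programmed, consKraus, Matrix.of_apply, Matrix.mul_apply, Finset.sum_mul_sum]
  rw [← (Fin.consEquiv fun _ => q).sum_comp, Fintype.sum_prod_type]
  symm
  rw [Finset.sum_comm]
  refine Finset.sum_congr rfl fun x _ => ?_
  rw [Finset.sum_comm]
  refine Finset.sum_congr rfl fun f _ => ?_
  rw [Finset.sum_mul]
  refine Finset.sum_congr rfl fun l _ => ?_
  have : Fin.tail ((Fin.consEquiv fun _ : Fin (n + 1) => q) (x, f)) = f := Fin.tail_cons _ _
  rw [this]
  simp only [Fin.consEquiv_apply, Fin.cons_zero, Fin.prod_univ_succ, Fin.cons_succ]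
  ring

theorem krausMap_mul (A : ι → Op m) (B : κ → Op m) :
    krausMap (fun p : ι × κ => A p.1 * B p.2) = krausMap A ∘ₗ krausMap B := by
  ext1 X
  simp only [krausMap_apply, LinearMap.comp_apply, Fintype.sum_prod_type, Finset.mul_sum,
    Finset.sum_mul, Matrix.conjTranspose_mul, Matrix.mul_assoc]

theorem sum_comm_pairs (F : ι → m → m → m → ℂ) :
    ∑ a, ∑ i, ∑ l, ∑ l', F a i l l' = ∑ l', ∑ l, ∑ a, ∑ i, F a i l l' := by
  calc ∑ a, ∑ i, ∑ l, ∑ l', F a i l l' = ∑ a, ∑ l, ∑ i, ∑ l', F a i l l' :=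
        Finset.sum_congr rfl fun _ _ => Finset.sum_comm
    _ = ∑ l, ∑ a, ∑ l', ∑ i, F a i l l' := by
        rw [Finset.sum_comm]
        exact Finset.sum_congr rfl fun _ _ => Finset.sum_congr rfl fun _ _ => Finset.sum_comm
    _ = ∑ l, ∑ l', ∑ a, ∑ i, F a i l l' := Finset.sum_congr rfl fun _ _ => Finset.sum_comm
    _ = _ := Finset.sum_comm

variable [DecidableEq m] [DecidableEq q]

omit [Fintype q] in
theorem consKraus_isometry {n : ℕ} {A : ι → Matrix m (m × q) ℂ}
    {B : κ → Matrix m (m × (Fin n → q)) ℂ} (hA : ∑ a, (A a)ᴴ * A a = 1)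
    (hB : ∑ b, (B b)ᴴ * B b = 1) : ∑ p, (consKraus A B p)ᴴ * consKraus A B p = 1 := by
  ext ⟨j, f⟩ ⟨j', f'⟩
  have hA' : ∀ x y, ∑ a, ∑ i, star (A a i x) * A a i y = if x = y then 1 else 0 := by
    intro x y
    have := congrFun (congrFun hA x) y
    simpa [Matrix.sum_apply, Matrix.mul_apply, Matrix.one_apply] using this
  have hB' : ∀ x y, ∑ b, ∑ i, star (B b i x) * B b i y = if x = y then 1 else 0 := by
    intro x y
    have := congrFun (congrFun hB x) y
    simpa [Matrix.sum_apply, Matrix.mul_apply, Matrix.one_apply] using this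
  calc (∑ p, (consKraus A B p)ᴴ * consKraus A B p) (j, f) (j', f')
      = ∑ b, ∑ l, ∑ l', star (B b l (j, Fin.tail f)) * B b l' (j', Fin.tail f') *
          ∑ a, ∑ i, star (A a i (l, f 0)) * A a i (l', f' 0) := by
        simp only [Matrix.sum_apply, Matrix.mul_apply, Matrix.conjTranspose_apply, consKraus,
          Matrix.of_apply, Fintype.sum_prod_type, star_sum, star_mul', Finset.sum_mul,
          Finset.mul_sum]
        rw [Finset.sum_comm]
        refine Finset.sum_congr rfl fun b _ => ?_
        rw [sum_comm_pairs]
        refine Finset.sum_congr rfl fun l _ => Finset.sum_congr rfl fun l' _ =>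
          Finset.sum_congr rfl fun a _ => Finset.sum_congr rfl fun i _ => ?_
        ring
    _ = if f 0 = f' 0 then
          ∑ b, ∑ l, star (B b l (j, Fin.tail f)) * B b l (j', Fin.tail f') else 0 := by
        simp only [hA', Prod.mk.injEq]
        split_ifs with h <;> simp [h]
    _ = (1 : Op (m × (Fin (n + 1) → q))) (j, f) (j', f') := by
        rw [hB', Matrix.one_apply]
        have : f = f' ↔ f 0 = f' 0 ∧ Fin.tail f = Fin.tail f' := by
          rw [← Fin.cons_self_tail f, ← Fin.cons_self_tail f', Fin.cons_inj]
          simp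
        simp only [Prod.mk.injEq, this]
        split_ifs <;> simp_all

/-- A programmable channel remains trace-preserving when it is given a unit program vector. -/
theorem sum_kraus_programmed {A : ι → Matrix m (m × q) ℂ}
    (hA : ∑ a, (A a)ᴴ * A a = 1) {v : q → ℂ} (hv : ∑ x, ‖v x‖ ^ 2 = 1) :
    ∑ a, (programmed A v a)ᴴ * programmed A v a = 1 := by
  set V : Matrix (m × q) m ℂ := Matrix.of fun x j => if x.1 = j then v x.2 else 0 with hV
  have h1 : ∀ a, programmed A v a = A a * V := by
    intro a
    ext i j
    simp [hV, programmed, Matrix.mul_apply, Fintype.sum_prod_type_right]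
  have h2 : V.conjTranspose * V = 1 := by
    have hv' : ∑ x, star (v x) * v x = 1 := by
      rw [← Complex.ofReal_one, ← hv]
      push_cast
      refine Finset.sum_congr rfl fun i _ => ?_
      rw [Complex.star_def, Complex.conj_mul']
    ext i j
    rw [Matrix.one_apply, ← hv']
    by_cases h : i = j <;>
      simp [hV, Matrix.mul_apply, Fintype.sum_prod_type_right, h, apply_ite (starRingEnd ℂ),
        eq_comm (a := j) (b := i)]
  simp only [h1, Matrix.conjTranspose_mul]
  calc ∑ a, V.conjTranspose * (A a)ᴴ * (A a * V) =
        V.conjTranspose * (∑ a, (A a)ᴴ * A a) * V := by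
          rw [Matrix.mul_sum, Matrix.sum_mul]
          simp only [Matrix.mul_assoc]
    _ = 1 := by rw [hA, Matrix.mul_one, h2]

/-- `n` rounds of the programmable channel with Kraus operators `A`, each on a fresh copy of the
program, form a single channel that does not depend on the program. -/
theorem exists_channel_pow {ι : Type} [Fintype ι] {A : ι → Matrix m (m × q) ℂ}
    (hA : ∑ a, (A a)ᴴ * A a = 1) (n : ℕ) :
    ∃ P : Op (m × (Fin n → q)) →ₗ[ℂ] Op m, IsCPTP P ∧ ∀ v : q → ℂ,
      P ∘ₗ appendCopies n (Matrix.vecMulVec v (star v)) = krausMap (programmed A v) ^ n := by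
  suffices h : ∃ (κ : Type) (_ : Fintype κ) (B : κ → Matrix m (m × (Fin n → q)) ℂ),
      ∑ b, (B b)ᴴ * B b = 1 ∧ ∀ v : q → ℂ,
        krausMap (programmed B fun f => ∏ k, v (f k)) = krausMap (programmed A v) ^ n by
    obtain ⟨κ, _, B, hB, h⟩ := h
    exact ⟨krausMap B, isCPTP_krausMap hB, fun v => by rw [krausMap_comp_appendCopies, h]⟩
  induction n with
  | zero =>
    refine ⟨Unit, inferInstance, fun _ => Matrix.of fun i x => if i = x.1 then 1 else 0, ?_, ?_⟩
    · ext ⟨j, f⟩ ⟨j', f'⟩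
      have : f = f' := Subsingleton.elim _ _
      simp [Matrix.mul_apply, Matrix.one_apply, this, eq_comm]
    · intro v
      have h1 : ∀ b : Unit, programmed (fun _ : Unit => (Matrix.of fun i x =>
          if i = x.1 then 1 else 0 : Matrix m (m × (Fin 0 → q)) ℂ))
          (fun f => ∏ k, v (f k)) b = 1 := by
        intro b
        ext i j
        by_cases h : i = j <;> simp [programmed, h, Matrix.one_apply]
      ext1 X
      rw [krausMap_apply]
      simp only [h1]
      simp
  | succ n ih =>
    obtain ⟨κ, _, B, hB, h⟩ := ih
    refine ⟨ι × κ, inferInstance, consKraus A B, consKraus_isometry hA hB, fun v => ?_⟩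
    have h1 : programmed (consKraus A B) (fun f => ∏ k, v (f k)) = fun p : ι × κ =>
        programmed A v p.1 * programmed B (fun f => ∏ k, v (f k)) p.2 :=
      funext fun p => programmed_consKraus A B v p
    rw [h1, krausMap_mul, h, pow_succ']
    rfl

end Programmed

/-! ### One simulation step -/

section StepChannel

variable {d : ℕ}

/-- The projection `Π` onto the maximally entangled state of the system (first factor) and the
second register of the program (third factor). -/
def entangledProj (d : ℕ) : Op (Fin d × (Fin d × Fin d)) :=
  Matrix.of fun x y => if x.2.1 = y.2.1 ∧ x.1 = x.2.2 ∧ y.1 = y.2.2 then (d : ℂ)⁻¹ else 0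

theorem entangledProj_conjTranspose : (entangledProj d)ᴴ = entangledProj d := by
  ext ⟨i, a, b⟩ ⟨j, a', b'⟩
  simp only [Matrix.conjTranspose_apply, entangledProj, Matrix.of_apply, apply_ite star]
  simp only [star_zero, star_inv₀, Complex.star_def, map_natCast]
  exact if_congr (by tauto) rfl rfl

theorem entangledProj_mul_self : entangledProj d * entangledProj d = entangledProj d := by
  ext ⟨i, a, b⟩ ⟨j, a', b'⟩
  have hd' : (d : ℂ) ≠ 0 := by exact_mod_cast (Fin.pos i).ne'
  simp only [Matrix.mul_apply, entangledProj, Matrix.of_apply, Fintype.sum_prod_type, ite_and,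
    mul_ite, ite_mul, mul_zero, zero_mul]
  split_ifs <;> simp_all

/-- The Kraus operators of one simulation step, with strength `c`. On `|φ⟩ ⊗ |L⟩` the operator
with index `none` outputs a multiple of `L φ`; the others apply `1 - c Π` and then measure the
program registers. -/
def stepKraus (d : ℕ) (c : ℝ) :
    Option (Fin d × Fin d) → Matrix (Fin d) (Fin d × (Fin d × Fin d)) ℂ
  | none => Matrix.of fun i x =>
      if i = x.2.1 ∧ x.1 = x.2.2 then ((√((2 * c - c ^ 2) / d) : ℝ) : ℂ) else 0
  | some p => Matrix.of fun i x => (1 - (c : ℂ) • entangledProj d) (i, p) x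

theorem stepKraus_isometry {c : ℝ} (h0 : 0 ≤ c) (h2 : c ≤ 2) :
    ∑ a, (stepKraus d c a)ᴴ * stepKraus d c a = 1 := by
  have hs : ((√((2 * c - c ^ 2) / d) : ℝ) : ℂ) * ((√((2 * c - c ^ 2) / d) : ℝ) : ℂ) =
      (2 * c - c ^ 2) * (d : ℂ)⁻¹ := by
    rw [← Complex.ofReal_mul, Real.mul_self_sqrt (div_nonneg (by nlinarith) (by positivity))]
    push_cast
    rw [div_eq_mul_inv]
  have hnone : (stepKraus d c none)ᴴ * stepKraus d c none =
      (2 * c - c ^ 2 : ℂ) • entangledProj d := by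
    ext ⟨i, a, b⟩ ⟨j, a', b'⟩
    simp only [Matrix.mul_apply, stepKraus, entangledProj, Matrix.of_apply, ite_and, mul_ite,
      Matrix.conjTranspose_apply, Matrix.smul_apply, smul_eq_mul, mul_zero, apply_ite star,
      star_zero, ite_mul, zero_mul, Complex.star_def, Complex.conj_ofReal, hs]
    clear hs
    by_cases h1 : a = a' <;> by_cases h2 : i = b <;> by_cases h3 : j = b' <;>
      simp_all [eq_comm]
  have hsome : ∑ p, (stepKraus d c (some p))ᴴ * stepKraus d c (some p) =
      (1 - (c : ℂ) • entangledProj d)ᴴ * (1 - (c : ℂ) • entangledProj d) := by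
    ext x y
    rw [Matrix.mul_apply, Matrix.sum_apply]
    conv_rhs => rw [Fintype.sum_prod_type_right]
    refine Finset.sum_congr rfl fun p _ => ?_
    simp only [Matrix.mul_apply, stepKraus, Matrix.of_apply, Matrix.conjTranspose_apply]
  rw [Fintype.sum_option, hnone, hsome, Matrix.conjTranspose_sub, Matrix.conjTranspose_one,
    Matrix.conjTranspose_smul, entangledProj_conjTranspose, Complex.star_def, Complex.conj_ofReal,
    sub_mul, mul_sub, mul_sub]
  simp only [one_mul, mul_one, Matrix.smul_mul, Matrix.mul_smul, entangledProj_mul_self]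
  module

theorem programmed_stepKraus_none (c : ℝ) (L : Op (Fin d)) :
    programmed (stepKraus d c) (programVector L) none =
      ((√((2 * c - c ^ 2) / d) : ℝ) : ℂ) • L := by
  ext i j
  simp [programmed, stepKraus, Fintype.sum_prod_type, programVector_apply, ite_and]

theorem programmed_stepKraus_some (c : ℝ) (L : Op (Fin d)) (p : Fin d × Fin d) :
    programmed (stepKraus d c) (programVector L) (some p) =
      L p.1 p.2 • (1 : Op (Fin d)) - (c / d : ℂ) • (Matrix.single p.2 p.1 1 * L) := by
  obtain ⟨a, b⟩ := p
  ext i j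
  simp only [programmed, stepKraus, entangledProj, Fintype.sum_prod_type, programVector_apply,
    ite_and, sub_mul, Finset.sum_sub_distrib, Matrix.one_apply, Matrix.single_apply,
    Matrix.mul_apply, Matrix.of_apply, Matrix.sub_apply, Matrix.smul_apply, Prod.mk.injEq,
    smul_eq_mul]
  by_cases h1 : i = b <;> by_cases h2 : i = j <;>
    simp [h1, h2, Ne.symm, div_eq_mul_inv, eq_comm (a := b)]

end StepChannel

/-! ### The simulation error of the iterated step channel -/

section Simulation

variable {d : ℕ} {r : Type*} [Fintype r] [DecidableEq r]

theorem heisenberg_lindbladian (L : Op (Fin d)) (U : Op (r × Fin d)) :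
    heisenberg r (lindbladian L) U =
      ((1 : Op r) ⊗ₖ L)ᴴ * U * ((1 : Op r) ⊗ₖ L) - (1 / 2 : ℂ) •
        (((1 : Op r) ⊗ₖ L)ᴴ * ((1 : Op r) ⊗ₖ L) * U +
          U * (((1 : Op r) ⊗ₖ L)ᴴ * ((1 : Op r) ⊗ₖ L))) := by
  set M : Op (r × Fin d) := (1 : Op r) ⊗ₖ L with hM
  have hMM : M.conjTranspose * M = (1 : Op r) ⊗ₖ (Lᴴ * L) := by
    rw [hM, one_kronecker_conjTranspose, ← Matrix.mul_kronecker_mul, Matrix.one_mul]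
  refine heisenberg_eq_of_trace fun X => ?_
  have hX : ampliate r (lindbladian L) X = M * X * M.conjTranspose - (1 / 2 : ℂ) •
      (M.conjTranspose * M * X + X * (M.conjTranspose * M)) := by
    have e1 := block_mul_mul (r := r) L Lᴴ X
    have e2 := block_mul_mul (r := r) (Lᴴ * L) 1 X
    have e3 := block_mul_mul (r := r) 1 (Lᴴ * L) X
    rw [Matrix.one_kronecker_one, Matrix.mul_one] at e2
    rw [Matrix.one_kronecker_one, Matrix.one_mul] at e3
    rw [hMM, hM, one_kronecker_conjTranspose, ← e1, ← e2, ← e3]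
    ext p q
    simp [ampliate, lindbladian]
  rw [hX]
  simp only [sub_mul, mul_sub, Matrix.smul_mul, Matrix.mul_smul, add_mul, mul_add,
    Matrix.trace_sub, Matrix.trace_smul, Matrix.trace_add]
  have t1 : (M.conjTranspose * U * M * X).trace = (U * (M * X * M.conjTranspose)).trace := by
    rw [Matrix.mul_assoc, Matrix.mul_assoc, Matrix.trace_mul_comm]
    simp only [Matrix.mul_assoc]
  have t2 : (M.conjTranspose * M * U * X).trace = (U * (X * (M.conjTranspose * M))).trace := by
    rw [Matrix.mul_assoc, Matrix.trace_mul_comm, Matrix.mul_assoc]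
  have t3 : (U * (M.conjTranspose * M) * X).trace = (U * (M.conjTranspose * M * X)).trace := by
    rw [Matrix.mul_assoc]
  rw [t1, t2, t3]
  ring

theorem norm_conjTranspose_kronecker_mul_le (L : Op (Fin d)) :
    ‖((1 : Op r) ⊗ₖ L)ᴴ * ((1 : Op r) ⊗ₖ L)‖ ≤ ‖L‖ ^ 2 := by
  rw [Matrix.l2_opNorm_conjTranspose_mul_self, sq]
  exact mul_self_le_mul_self (norm_nonneg _) (l2_opNorm_one_kronecker_le L)

theorem norm_heisenberg_lindbladian_le (L : Op (Fin d)) :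
    ‖heisenberg r (lindbladian L)‖ ≤ 2 * ‖L‖ ^ 2 := by
  refine ContinuousLinearMap.opNorm_le_bound _ (by positivity) fun U => ?_
  rw [heisenberg_lindbladian]
  set M : Op (r × Fin d) := (1 : Op r) ⊗ₖ L
  have hM : ‖M‖ ≤ ‖L‖ := l2_opNorm_one_kronecker_le L
  have hMM : ‖M.conjTranspose * M‖ ≤ ‖L‖ ^ 2 := norm_conjTranspose_kronecker_mul_le L
  have e1 : ‖M.conjTranspose * U * M‖ ≤ ‖L‖ ^ 2 * ‖U‖ := by
    calc ‖M.conjTranspose * U * M‖ ≤ ‖M‖ * ‖U‖ * ‖M‖ := by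
          refine (norm_mul_le _ _).trans ?_
          gcongr
          refine (norm_mul_le _ _).trans ?_
          rw [Matrix.l2_opNorm_conjTranspose]
      _ ≤ ‖L‖ * ‖U‖ * ‖L‖ := by gcongr
      _ = _ := by ring
  have e2 : ‖(1 / 2 : ℂ) • (M.conjTranspose * M * U + U * (M.conjTranspose * M))‖ ≤
      ‖L‖ ^ 2 * ‖U‖ := by
    rw [norm_smul]
    calc ‖(1 / 2 : ℂ)‖ * ‖M.conjTranspose * M * U + U * (M.conjTranspose * M)‖
        ≤ (1 / 2) * (‖L‖ ^ 2 * ‖U‖ + ‖U‖ * ‖L‖ ^ 2) := by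
          gcongr
          · norm_num
          · refine (norm_add_le _ _).trans (add_le_add ?_ ?_)
            · exact (norm_mul_le _ _).trans (by gcongr)
            · exact (norm_mul_le _ _).trans (by gcongr)
      _ = _ := by ring
  refine (norm_sub_le _ _).trans ((add_le_add e1 e2).trans (le_of_eq (by ring)))

/-- The channel that one step of the simulation, with strength `c` and program `|L⟩`, induces on
the system. -/
def stepChannel (c : ℝ) (L : Op (Fin d)) : Op (Fin d) →ₗ[ℂ] Op (Fin d) :=
  krausMap (programmed (stepKraus d c) (programVector L))

/-- One simulation step in the Heisenberg picture. The first two corrections are the jump and the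
anticommutator of the Lindbladian, with slightly different weights; the last one is of second order
in the strength. Normalization of the program enters through the coefficient of `U`. -/
theorem heisenberg_stepChannel {c : ℝ} (h0 : 0 ≤ c) (h2 : c ≤ 2) {L : Op (Fin d)}
    (hL : ∑ i, ∑ j, ‖L i j‖ ^ 2 = 1) (U : Op (r × Fin d)) :
    heisenberg r (stepChannel c L) U = U
      + ((2 * c - c ^ 2) / d : ℂ) • (((1 : Op r) ⊗ₖ L)ᴴ * U * ((1 : Op r) ⊗ₖ L))
      - (c / d : ℂ) • (((1 : Op r) ⊗ₖ L)ᴴ * ((1 : Op r) ⊗ₖ L) * U +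
          U * (((1 : Op r) ⊗ₖ L)ᴴ * ((1 : Op r) ⊗ₖ L)))
      + (c / d : ℂ) ^ 2 • ∑ p : Fin d × Fin d,
          ((1 : Op r) ⊗ₖ (Matrix.single p.2 p.1 1 * L))ᴴ * U *
            ((1 : Op r) ⊗ₖ (Matrix.single p.2 p.1 1 * L)) := by
  set M : Op (r × Fin d) := (1 : Op r) ⊗ₖ L with hM
  set S : Fin d × Fin d → Op (r × Fin d) := fun p =>
    (1 : Op r) ⊗ₖ (Matrix.single p.2 p.1 1 : Op (Fin d)) with hS
  have hSM : ∀ p : Fin d × Fin d,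
      (1 : Op r) ⊗ₖ (Matrix.single p.2 p.1 1 * L : Op (Fin d)) = S p * M := by
    intro p
    rw [hM, hS, ← Matrix.mul_kronecker_mul, Matrix.one_mul]
  have hsum : ∑ p : Fin d × Fin d, star (L p.1 p.2) • S p = M.conjTranspose := by
    have : Lᴴ = ∑ p : Fin d × Fin d,
        star (L p.1 p.2) • (Matrix.single p.2 p.1 1 : Op (Fin d)) := by
      ext i j
      simp [Matrix.sum_apply, Fintype.sum_prod_type, Matrix.single_apply, ite_and]
    rw [hM, one_kronecker_conjTranspose, this]
    ext ⟨a, i⟩ ⟨b, j⟩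
    simp only [hS, Matrix.sum_apply, Matrix.smul_apply, Matrix.kroneckerMap_apply, Finset.mul_sum,
      smul_eq_mul]
    exact Finset.sum_congr rfl fun p _ => by ring
  have hsum' : ∑ p : Fin d × Fin d, L p.1 p.2 • (S p).conjTranspose = M := by
    have := congrArg Matrix.conjTranspose hsum
    simpa [Matrix.conjTranspose_sum] using this
  have hone : ∑ p : Fin d × Fin d, star (L p.1 p.2) * L p.1 p.2 = 1 := by
    rw [← Complex.ofReal_one, ← hL, Fintype.sum_prod_type]
    push_cast
    refine Finset.sum_congr rfl fun i _ => Finset.sum_congr rfl fun j _ => ?_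
    rw [Complex.star_def, Complex.conj_mul']
  have hs : ((√((2 * c - c ^ 2) / d) : ℝ) : ℂ) * ((√((2 * c - c ^ 2) / d) : ℝ) : ℂ) =
      (2 * c - c ^ 2) / d := by
    rw [← Complex.ofReal_mul, Real.mul_self_sqrt (div_nonneg (by nlinarith) (by positivity))]
    push_cast
    rfl
  rw [stepChannel, heisenberg_krausMap, Fintype.sum_option]
  have hnone : (1 : Op r) ⊗ₖ programmed (stepKraus d c) (programVector L) none =
      ((√((2 * c - c ^ 2) / d) : ℝ) : ℂ) • M := by
    rw [programmed_stepKraus_none, Matrix.kronecker_smul]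
  have hsome : ∀ p, (1 : Op r) ⊗ₖ programmed (stepKraus d c) (programVector L) (some p) =
      L p.1 p.2 • (1 : Op (r × Fin d)) - (c / d : ℂ) • (S p * M) := by
    intro p
    rw [programmed_stepKraus_some, ← hSM]
    ext ⟨a, i⟩ ⟨b, j⟩
    by_cases h : a = b <;> simp [h, Matrix.one_apply]
  have hterm : ∀ p : Fin d × Fin d,
      (L p.1 p.2 • (1 : Op (r × Fin d)) - (c / d : ℂ) • (S p * M)).conjTranspose * U *
        (L p.1 p.2 • (1 : Op (r × Fin d)) - (c / d : ℂ) • (S p * M)) =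
      (star (L p.1 p.2) * L p.1 p.2) • U
        - (c / d : ℂ) • (M.conjTranspose * (L p.1 p.2 • (S p).conjTranspose) * U)
        - (c / d : ℂ) • (U * (star (L p.1 p.2) • S p) * M)
        + (c / d : ℂ) ^ 2 • ((S p * M).conjTranspose * U * (S p * M)) := by
    intro p
    have hc : star (c / d : ℂ) = (c / d : ℂ) := by simp
    rw [Matrix.conjTranspose_sub, Matrix.conjTranspose_smul, Matrix.conjTranspose_smul,
      Matrix.conjTranspose_one, hc]
    simp only [sub_mul, mul_sub, Matrix.smul_mul, Matrix.mul_smul, one_mul, mul_one, smul_smul,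
      Matrix.conjTranspose_mul, Matrix.mul_assoc]
    module
  simp only [hnone, hsome, hSM, hterm, Finset.sum_add_distrib, Finset.sum_sub_distrib,
    ← Finset.sum_smul, ← Finset.smul_sum, ← Finset.sum_mul, ← Finset.mul_sum, hsum, hsum', hone]
  rw [Matrix.conjTranspose_smul, Complex.star_def, Complex.conj_ofReal, Matrix.smul_mul,
    Matrix.smul_mul, Matrix.mul_smul, smul_smul, hs]
  simp only [Matrix.mul_assoc]
  module

theorem sum_conjTranspose_single_mul (L : Op (Fin d)) :
    ∑ p : Fin d × Fin d, ((1 : Op r) ⊗ₖ (Matrix.single p.2 p.1 1 * L))ᴴ *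
      ((1 : Op r) ⊗ₖ (Matrix.single p.2 p.1 1 * L)) =
      (d : ℂ) • (((1 : Op r) ⊗ₖ L)ᴴ * ((1 : Op r) ⊗ₖ L)) := by
  have h1 : ∀ p : Fin d × Fin d, ((1 : Op r) ⊗ₖ (Matrix.single p.2 p.1 1 * L : Op (Fin d)))ᴴ *
      ((1 : Op r) ⊗ₖ (Matrix.single p.2 p.1 1 * L)) =
      (1 : Op r) ⊗ₖ (Lᴴ * (Matrix.single p.1 p.1 1 : Op (Fin d)) * L) := by
    intro p
    rw [one_kronecker_conjTranspose, ← Matrix.mul_kronecker_mul, Matrix.one_mul,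
      Matrix.conjTranspose_mul, Matrix.conjTranspose_single, star_one, Matrix.mul_assoc,
      ← Matrix.mul_assoc (Matrix.single p.1 p.2 1), Matrix.single_mul_single_same, one_mul,
      ← Matrix.mul_assoc]
  have h2 : ∑ i : Fin d, (Matrix.single i i 1 : Op (Fin d)) = 1 := by
    ext i j
    simp [Matrix.sum_apply, Matrix.single_apply, Matrix.one_apply, ite_and]
  have h3 : ∑ i : Fin d, Lᴴ * (Matrix.single i i 1 : Op (Fin d)) * L = Lᴴ * L := by
    rw [← Finset.sum_mul, ← Finset.mul_sum, h2, Matrix.mul_one]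
  simp only [h1, Fintype.sum_prod_type, Finset.sum_const, Finset.card_univ, Fintype.card_fin]
  rw [one_kronecker_conjTranspose, ← Matrix.mul_kronecker_mul, Matrix.one_mul, ← h3]
  ext ⟨a, i⟩ ⟨b, j⟩
  simp only [Matrix.sum_apply, Matrix.smul_apply, Matrix.kroneckerMap_apply, Finset.mul_sum,
    smul_eq_mul]
  simp only [nsmul_eq_mul]

theorem norm_heisenberg_stepChannel_le_one {c : ℝ} (h0 : 0 ≤ c) (h2 : c ≤ 2) {L : Op (Fin d)}
    (hL : ∑ i, ∑ j, ‖L i j‖ ^ 2 = 1) : ‖heisenberg r (stepChannel c L)‖ ≤ 1 := by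
  refine norm_heisenberg_krausMap_le_one (sum_kraus_programmed (stepKraus_isometry h0 h2) ?_)
  rw [Fintype.sum_prod_type, ← hL]
  simp only [programVector_apply]

/-- One step of strength `c` simulates the Lindbladian for time `(2 c - c²) / d`, up to an error of
second order in `c`. -/
theorem norm_heisenberg_stepChannel_sub_le (hd : 0 < d) {c : ℝ} (h0 : 0 ≤ c) (h2 : c ≤ 2)
    {L : Op (Fin d)} (hL : ∑ i, ∑ j, ‖L i j‖ ^ 2 = 1) :
    ‖heisenberg r (stepChannel c L) - 1 - ((2 * c - c ^ 2) / d) • heisenberg r (lindbladian L)‖ ≤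
      2 * c ^ 2 / d * ‖L‖ ^ 2 := by
  have hd' : (0 : ℝ) < d := by exact_mod_cast hd
  refine ContinuousLinearMap.opNorm_le_bound _ (by positivity) fun U => ?_
  have hMM := norm_conjTranspose_kronecker_mul_le (r := r) L
  have hT := norm_sum_conjTranspose_mul_mul_le
    (fun p : Fin d × Fin d => (1 : Op r) ⊗ₖ (Matrix.single p.2 p.1 1 * L : Op (Fin d))) U
  rw [sum_conjTranspose_single_mul, norm_smul, Complex.norm_natCast] at hT
  rw [sub_apply, sub_apply, smul_apply, heisenberg_stepChannel h0 h2 hL, heisenberg_lindbladian]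
  set M : Op (r × Fin d) := (1 : Op r) ⊗ₖ L
  set T : Op (r × Fin d) := ∑ p : Fin d × Fin d,
    ((1 : Op r) ⊗ₖ (Matrix.single p.2 p.1 1 * L : Op (Fin d)))ᴴ * U *
      ((1 : Op r) ⊗ₖ (Matrix.single p.2 p.1 1 * L))
  set Q : Op (r × Fin d) := M.conjTranspose * M * U + U * (M.conjTranspose * M)
  have hQ : ‖Q‖ ≤ 2 * ‖L‖ ^ 2 * ‖U‖ := by
    calc ‖Q‖ ≤ ‖L‖ ^ 2 * ‖U‖ + ‖U‖ * ‖L‖ ^ 2 :=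
          (norm_add_le _ _).trans (add_le_add ((norm_mul_le _ _).trans (by gcongr))
            ((norm_mul_le _ _).trans (by gcongr)))
      _ = _ := by ring
  have key : U + ((2 * c - c ^ 2) / d : ℂ) • (M.conjTranspose * U * M) - (c / d : ℂ) • Q
      + (c / d : ℂ) ^ 2 • T - (1 : Op (r × Fin d) →L[ℂ] Op (r × Fin d)) U
      - ((2 * c - c ^ 2) / d : ℝ) • (M.conjTranspose * U * M - (1 / 2 : ℂ) • Q) =
      ((c / d) ^ 2 : ℝ) • T - (c ^ 2 / (2 * d) : ℝ) • Q := by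
    rw [one_apply_eq_self]
    simp only [← Complex.coe_smul]
    push_cast
    have : ((c : ℂ) ^ 2 / (2 * d)) = (c / d : ℂ) - (2 * c - c ^ 2) / d * (1 / 2) := by
      field_simp
      ring
    rw [this]
    module
  rw [key]
  calc ‖((c / d) ^ 2 : ℝ) • T - (c ^ 2 / (2 * d) : ℝ) • Q‖
      ≤ (c / d) ^ 2 * ‖T‖ + c ^ 2 / (2 * d) * ‖Q‖ := by
        refine (norm_sub_le _ _).trans (le_of_eq ?_)
        rw [norm_smul, norm_smul, Real.norm_of_nonneg (by positivity),
          Real.norm_of_nonneg (by positivity)]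
    _ ≤ (c / d) ^ 2 * (d * ‖L‖ ^ 2 * ‖U‖) + c ^ 2 / (2 * d) * (2 * ‖L‖ ^ 2 * ‖U‖) := by
        gcongr
        exact hT.trans (by gcongr)
    _ = _ := by
        field_simp
        ring

theorem norm_one_clm_le {E : Type*} [SeminormedAddCommGroup E] [NormedSpace ℂ E] :
    ‖(1 : E →L[ℂ] E)‖ ≤ 1 := ContinuousLinearMap.norm_id_le

/-- The Lindblad semigroup is contractive: it is a limit of powers of the step channels. -/
theorem norm_exp_heisenberg_lindbladian_le_one (hd : 0 < d) {L : Op (Fin d)}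
    (hL : ∑ i, ∑ j, ‖L i j‖ ^ 2 = 1) {t : ℝ} (ht : 0 ≤ t) :
    ‖NormedSpace.exp (t • heisenberg r (lindbladian L))‖ ≤ 1 := by
  let : NormedAlgebra ℚ (Op (r × Fin d) →L[ℂ] Op (r × Fin d)) :=
    NormedAlgebra.restrictScalars ℚ ℝ _
  have hd' : (0 : ℝ) < d := by exact_mod_cast hd
  refine norm_exp_smul_le_one (𝔸 := Op (r × Fin d) →L[ℂ] Op (r × Fin d)) norm_one_clm_le
    (fun η hη => ?_) ht
  refine ⟨min (1 / d) (η / (2 * d * ‖L‖ ^ 2 + 1)), by positivity, fun s hs hs' => ?_⟩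
  have h1 : s * d < 1 := by
    have := hs'.trans_le (min_le_left _ _)
    rwa [lt_div_iff₀ hd'] at this
  have h2 : s * (2 * d * ‖L‖ ^ 2 + 1) < η := by
    have := hs'.trans_le (min_le_right _ _)
    rwa [lt_div_iff₀ (by positivity)] at this
  -- The strength with `2 c - c² = s d`.
  set c : ℝ := 1 - √(1 - s * d) with hc
  have hsq : √(1 - s * d) ^ 2 = 1 - s * d := Real.sq_sqrt (by linarith)
  have hs0 : 0 ≤ √(1 - s * d) := Real.sqrt_nonneg _
  have hs1 : √(1 - s * d) ≤ 1 := Real.sqrt_le_one.2 (by nlinarith)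
  have hcs : (2 * c - c ^ 2) / d = s := by
    rw [div_eq_iff hd'.ne', hc]
    nlinarith
  have hc0 : 0 ≤ c := by linarith
  have hcle : c ≤ s * d := by nlinarith
  have hE := norm_heisenberg_stepChannel_le_one (r := r) hc0 (by linarith) hL
  have hD := norm_heisenberg_stepChannel_sub_le (r := r) hd hc0 (by linarith) hL
  rw [hcs] at hD
  set E := heisenberg r (stepChannel c L)
  have h3 : 1 + s • heisenberg r (lindbladian L) =
      E - (E - 1 - s • heisenberg r (lindbladian L)) := by abel
  rw [h3]
  refine (norm_sub_le _ _).trans (add_le_add hE (hD.trans ?_))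
  calc 2 * c ^ 2 / d * ‖L‖ ^ 2 ≤ 2 * (s * d) ^ 2 / d * ‖L‖ ^ 2 := by gcongr
    _ = s * (2 * d * ‖L‖ ^ 2) * s := by field_simp
    _ ≤ η * s := by
        gcongr
        nlinarith

/-- Simulation with `n` program copies by a channel that does not depend on the program: the
normalized diamond error is at most `(d ‖L‖² / 2 + ‖L‖⁴) t² / n`, in the operator norm `‖L‖`. -/
theorem exists_channel_simulationError_le (hd : 0 < d) {n : ℕ} (hn : 0 < n) {t : ℝ} (ht : 0 ≤ t) :
    ∃ P : Op (Fin d × (Fin n → Fin d × Fin d)) →ₗ[ℂ] Op (Fin d), IsCPTP P ∧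
      ∀ L : Op (Fin d), ∑ i, ∑ j, ‖L i j‖ ^ 2 = 1 →
        simulationError P L t ≤
          ENNReal.ofReal ((d * ‖L‖ ^ 2 / 2 + (‖L‖ ^ 2) ^ 2) * (t ^ 2 / n)) := by
  have hd' : (0 : ℝ) < d := by exact_mod_cast hd
  have hn' : (0 : ℝ) < n := by exact_mod_cast hn
  set u : ℝ := t * d / n with hu
  have hu0 : 0 ≤ u := by positivity
  -- The strength is capped at `1/2`, where `c² + (u - (2 c - c²))` is minimal.
  obtain ⟨c, h0, h1, hcu, hcost⟩ : ∃ c : ℝ, 0 ≤ c ∧ c ≤ 1 ∧ 2 * c - c ^ 2 ≤ u ∧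
      c ^ 2 + (u - (2 * c - c ^ 2)) ≤ u ^ 2 / 2 := by
    rcases le_total u 1 with h | h
    · exact ⟨u / 2, by positivity, by linarith, by nlinarith, by nlinarith⟩
    · exact ⟨1 / 2, by norm_num, by norm_num, by nlinarith, by nlinarith [sq_nonneg (u - 1)]⟩
  set σ : ℝ := 2 * c - c ^ 2 with hσ
  have hσ0 : 0 ≤ σ := by nlinarith
  obtain ⟨P, hP, hPv⟩ := exists_channel_pow (stepKraus_isometry (d := d) h0 (by linarith)) n
  refine ⟨P, hP, fun L hL => ?_⟩
  have hPL : P ∘ₗ appendCopies n (programState L) = stepChannel c L ^ n := hPv (programVector L)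
  rw [simulationError, hPL]
  have hbound : diamondNorm (stepChannel c L ^ n - superExp ((t : ℂ) • lindbladian L)) ≤
      ENNReal.ofReal (2 * ((d * ‖L‖ ^ 2 / 2 + (‖L‖ ^ 2) ^ 2) * (t ^ 2 / n))) := by
    refine diamondNorm_le_of_heisenberg fun k => ?_
    let : NormedAlgebra ℚ (Op (Fin k × Fin d) →L[ℂ] Op (Fin k × Fin d)) :=
      NormedAlgebra.restrictScalars ℚ ℝ _
    rw [map_sub, heisenberg_superExp, heisenberg_pow, map_smul,
      show (t : ℂ) • heisenberg (Fin k) (lindbladian L) = t • heisenberg (Fin k) (lindbladian L)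
        from
        ContinuousLinearMap.ext fun U => Complex.coe_smul t (heisenberg (Fin k) (lindbladian L) U)]
    have hrt : σ / d ≤ t / n := by
      rw [div_le_iff₀ hd']
      calc σ ≤ u := hcu
        _ = _ := by rw [hu]; ring
    have hE := norm_heisenberg_stepChannel_le_one (r := Fin k) h0 (h1.trans one_le_two) hL
    have hA : ∀ s : ℝ, 0 ≤ s →
        ‖NormedSpace.exp (s • heisenberg (Fin k) (lindbladian L))‖ ≤ 1 :=
      fun s hs => norm_exp_heisenberg_lindbladian_le_one hd hL hs
    refine (norm_pow_sub_exp_le (𝔸 := Op (Fin k × Fin d) →L[ℂ] Op (Fin k × Fin d)) hA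
      norm_one_clm_le hE hn (r := σ / d) (by positivity) hrt).trans ?_
    have e1 := norm_heisenberg_stepChannel_sub_le (r := Fin k) hd h0 (by linarith) hL
    rw [← hσ] at e1
    have e2 := norm_heisenberg_lindbladian_le (r := Fin k) L
    set K : ℝ := ‖L‖ ^ 2 with hK
    have hK0 : 0 ≤ K := by positivity
    set A := heisenberg (Fin k) (lindbladian L)
    calc n * (‖heisenberg (Fin k) (stepChannel c L) - 1 - (σ / d) • A‖ +
          ‖A‖ * (t / n - σ / d) + ‖A‖ ^ 2 * (σ / d) ^ 2 / 2)
        ≤ n * (2 * c ^ 2 / d * K + 2 * K * (t / n - σ / d) + (2 * K) ^ 2 * (t / n) ^ 2 / 2) := by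
          have : 0 ≤ t / n - σ / d := sub_nonneg.2 hrt
          gcongr
      _ = 2 * (n * (K / d * (c ^ 2 + (u - σ)) + K ^ 2 * (t / n) ^ 2)) := by
          rw [hu]
          field_simp
      _ ≤ 2 * (n * (K / d * (u ^ 2 / 2) + K ^ 2 * (t / n) ^ 2)) := by gcongr
      _ = _ := by
          rw [hu]
          field_simp
  calc diamondNorm (stepChannel c L ^ n - superExp ((t : ℂ) • lindbladian L)) / 2
      ≤ ENNReal.ofReal (2 * ((d * ‖L‖ ^ 2 / 2 + (‖L‖ ^ 2) ^ 2) * (t ^ 2 / n))) / 2 := by gcongr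
    _ = _ := by
        rw [ENNReal.ofReal_mul zero_le_two, ENNReal.ofReal_ofNat, mul_comm,
          ENNReal.mul_div_cancel_right (by norm_num) (by norm_num)]

/-- At time zero no program copies are needed. -/
theorem exists_channel_simulationError_zero :
    ∃ P : Op (Fin d × (Fin 0 → Fin d × Fin d)) →ₗ[ℂ] Op (Fin d), IsCPTP P ∧
      ∀ L : Op (Fin d), simulationError P L 0 = 0 := by
  obtain ⟨P, hP, hPv⟩ := exists_channel_pow
    (stepKraus_isometry (d := d) (c := 0) le_rfl zero_le_two) 0
  refine ⟨P, hP, fun L => ?_⟩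
  have hPL : P ∘ₗ appendCopies 0 (programState L) = 1 := by
    have := hPv (programVector L)
    rwa [pow_zero] at this
  rw [simulationError, hPL]
  have : diamondNorm (1 - superExp (((0 : ℝ) : ℂ) • lindbladian L)) ≤ ENNReal.ofReal 0 := by
    refine diamondNorm_le_of_heisenberg fun k => ?_
    rw [map_sub, heisenberg_superExp, heisenberg_one, Complex.ofReal_zero, zero_smul, map_zero,
      NormedSpace.exp_zero, sub_self, norm_zero]
  simpa using this

end Simulation

/-! ### Gaussian densities -/

section Density

/-- A finite power of a probability measure with positive density has the product density. -/
theorem pi_withDensity {ι X : Type*} [Fintype ι] [MeasurableSpace X] (μ : Measure X)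
    [SigmaFinite μ] {f : X → ℝ≥0∞} (hf : Measurable f) (h0 : ∀ x, f x ≠ 0) (htop : ∀ x, f x ≠ ∞)
    [IsProbabilityMeasure (μ.withDensity f)] :
    Measure.pi (fun _ : ι => μ.withDensity f) =
      (Measure.pi fun _ : ι => μ).withDensity fun x => ∏ i, f (x i) := by
  set ν := μ.withDensity f with hν
  set P : Measure (ι → X) := Measure.pi fun _ => ν with hP
  have hF : Measurable fun x : ι → X => ∏ i, (f (x i))⁻¹ := by fun_prop
  have hinv : ν.withDensity (fun x => (f x)⁻¹) = μ :=
    withDensity_inv_same hf (Filter.Eventually.of_forall h0) (Filter.Eventually.of_forall htop)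
  -- Dividing out the densities turns the power of `ν` into the power of `μ`, by independence.
  have key : P.withDensity (fun x => ∏ i, (f (x i))⁻¹) = Measure.pi fun _ : ι => μ := by
    symm
    refine Measure.pi_eq fun s hs => ?_
    rw [withDensity_apply _ (MeasurableSet.univ_pi hs),
      ← lintegral_indicator (MeasurableSet.univ_pi hs)]
    have hind : ∀ x : ι → X, (Set.univ.pi s).indicator (fun x => ∏ i, (f (x i))⁻¹) x =
        ∏ i, (s i).indicator (fun y => (f y)⁻¹) (x i) := by
      intro x
      by_cases hx : ∀ i, x i ∈ s i
      · rw [Set.indicator_of_mem (by simpa using hx)]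
        exact Finset.prod_congr rfl fun i _ => (Set.indicator_of_mem (hx i) fun y => (f y)⁻¹).symm
      · rw [Set.indicator_of_notMem (by simpa using hx)]
        push Not at hx
        obtain ⟨i, hi⟩ := hx
        exact (Finset.prod_eq_zero (Finset.mem_univ i) (Set.indicator_of_notMem hi _)).symm
    simp only [hind]
    have hmeas : ∀ i, Measurable ((s i).indicator fun y => (f y)⁻¹) :=
      fun i => hf.inv.indicator (hs i)
    rw [ProbabilityTheory.lintegral_prod_eq_prod_lintegral_of_indepFun Finset.univ
      (fun i (x : ι → X) => (s i).indicator (fun y => (f y)⁻¹) (x i))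
      (ProbabilityTheory.iIndepFun_pi fun i => (hmeas i).aemeasurable)
      (fun i => (hmeas i).comp (measurable_pi_apply i))]
    refine Finset.prod_congr rfl fun i _ => ?_
    rw [(measurePreserving_eval (fun _ : ι => ν) i).lintegral_comp (hmeas i),
      lintegral_indicator (hs i), ← withDensity_apply _ (hs i), hinv]
  rw [← key]
  have h1 : (fun x : ι → X => ∏ i, f (x i)) = (fun x => ∏ i, (f (x i))⁻¹)⁻¹ := by
    funext x
    rw [Pi.inv_apply, ENNReal.prod_inv_distrib]
    · simp
    · intro i _ j _ _
      left
      simpa using htop _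
  rw [h1]
  refine (withDensity_inv_same hF ?_ ?_).symm
  · exact Filter.Eventually.of_forall fun x =>
      Finset.prod_ne_zero_iff.2 fun i _ => ENNReal.inv_ne_zero.2 (htop _)
  · exact Filter.Eventually.of_forall fun x =>
      ENNReal.prod_ne_top fun i _ => ENNReal.inv_ne_top.2 (h0 _)

instance : IsProbabilityMeasure complexGaussian := by
  unfold complexGaussian
  exact Measure.isProbabilityMeasure_map (by fun_prop)

theorem complexGaussian_eq_withDensity :
    complexGaussian = volume.withDensity fun z =>
      ENNReal.ofReal (Real.pi⁻¹ * Real.exp (-‖z‖ ^ 2)) := by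
  have hg : ProbabilityTheory.gaussianReal 0 (1 / 2) =
      volume.withDensity (ProbabilityTheory.gaussianPDF 0 (1 / 2)) :=
    ProbabilityTheory.gaussianReal_of_var_ne_zero _ (by norm_num)
  have hm := ProbabilityTheory.measurable_gaussianPDF 0 (1 / 2)
  rw [complexGaussian, hg, prod_withDensity hm hm]
  have hmp := Complex.volume_preserving_equiv_real_prod
  refine Measure.ext fun s hs => ?_
  rw [Measure.map_apply Complex.measurableEquivRealProd.symm.measurable hs,
    withDensity_apply _ (Complex.measurableEquivRealProd.symm.measurable hs),
    withDensity_apply _ hs]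
  rw [← Measure.volume_eq_prod, ← hmp.map_eq, Complex.measurableEquivRealProd.restrict_map,
    lintegral_map_equiv]
  have : Complex.measurableEquivRealProd ⁻¹' (Complex.measurableEquivRealProd.symm ⁻¹' s) = s := by
    ext z
    simp
  rw [this]
  refine lintegral_congr fun z => ?_
  simp only [ProbabilityTheory.gaussianPDF]
  rw [← ENNReal.ofReal_mul (ProbabilityTheory.gaussianPDFReal_nonneg _ _ _)]
  congr 1
  simp only [ProbabilityTheory.gaussianPDFReal, Complex.measurableEquivRealProd_apply]
  rw [← Complex.normSq_eq_norm_sq, Complex.normSq_apply]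
  push_cast
  have hpi : √(2 * Real.pi * (1 / 2)) * √(2 * Real.pi * (1 / 2)) = Real.pi := by
    rw [Real.mul_self_sqrt (by positivity)]
    ring
  calc (√(2 * Real.pi * (1 / 2)))⁻¹ * Real.exp (-(z.re - 0) ^ 2 / (2 * (1 / 2))) *
        ((√(2 * Real.pi * (1 / 2)))⁻¹ * Real.exp (-(z.im - 0) ^ 2 / (2 * (1 / 2))))
      = (√(2 * Real.pi * (1 / 2)) * √(2 * Real.pi * (1 / 2)))⁻¹ *
        (Real.exp (-(z.re - 0) ^ 2 / (2 * (1 / 2))) *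
          Real.exp (-(z.im - 0) ^ 2 / (2 * (1 / 2)))) := by
        rw [mul_inv]
        ring
    _ = _ := by
        rw [hpi, ← Real.exp_add]
        congr 2
        ring

/-- A measure is Gaussian-shaped if its density with respect to the volume is a multiple of
`exp (-‖x‖²)`. -/
def IsGaussianShaped {E : Type*} [NormedAddCommGroup E] [InnerProductSpace ℝ E]
    [FiniteDimensional ℝ E] [MeasurableSpace E] [BorelSpace E] (μ : Measure E) : Prop :=
  ∃ c : ℝ≥0∞, μ = c • volume.withDensity fun x => ENNReal.ofReal (Real.exp (-‖x‖ ^ 2))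

/-- Gaussian shape may be checked on densities with respect to any Haar measure, after a linear
identification with a Euclidean space; the normalizing constant is left unspecified. -/
theorem isGaussianShaped_map {X E : Type*} [NormedAddCommGroup X] [NormedSpace ℝ X]
    [FiniteDimensional ℝ X] [MeasurableSpace X] [BorelSpace X] [NormedAddCommGroup E]
    [InnerProductSpace ℝ E] [FiniteDimensional ℝ E] [MeasurableSpace E] [BorelSpace E]
    (m : Measure X) [m.IsAddHaarMeasure] (e : X ≃L[ℝ] E) (C : ℝ≥0∞) :
    IsGaussianShaped ((m.withDensity fun x =>
      C * ENNReal.ofReal (Real.exp (-‖e x‖ ^ 2))).map e) := by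
  have hmeas : Measurable fun x : E => ENNReal.ofReal (Real.exp (-‖x‖ ^ 2)) := by fun_prop
  have he : Measurable e := e.continuous.measurable
  have : (m.map e).IsAddHaarMeasure := e.isAddHaarMeasure_map m
  obtain h := Measure.isAddLeftInvariant_eq_smul (m.map e) (volume : Measure E)
  set c := (m.map e).addHaarScalarFactor volume
  refine ⟨C * c, ?_⟩
  have h1 : (m.withDensity fun x => C * ENNReal.ofReal (Real.exp (-‖e x‖ ^ 2))) =
      C • m.withDensity fun x => ENNReal.ofReal (Real.exp (-‖e x‖ ^ 2)) := by
    rw [← withDensity_smul _ (by fun_prop)]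
    rfl
  rw [h1, Measure.map_smul, mul_smul]
  congr 1
  have h2 : (m.withDensity fun x => ENNReal.ofReal (Real.exp (-‖e x‖ ^ 2))).map e =
      (m.map e).withDensity fun x => ENNReal.ofReal (Real.exp (-‖x‖ ^ 2)) := by
    refine Measure.ext fun s hs => ?_
    rw [Measure.map_apply he hs, withDensity_apply _ (he hs), withDensity_apply _ hs,
      setLIntegral_map hs hmeas he]
  rw [h2, h]
  exact withDensity_smul_measure (c : ℝ≥0∞) _

end Density

section StandardGaussian

variable {ι : Type*} [Fintype ι]

/-- The standard Gaussian law of a vector of independent standard complex Gaussian variables. -/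
def stdComplexGaussian (ι : Type*) [Fintype ι] : Measure (EuclideanSpace ℂ ι) :=
  (Measure.pi fun _ : ι => complexGaussian).map (WithLp.toLp 2)

instance : IsProbabilityMeasure (stdComplexGaussian ι) := by
  unfold stdComplexGaussian
  exact Measure.isProbabilityMeasure_map (by fun_prop)

theorem pi_complexGaussian_eq_withDensity :
    Measure.pi (fun _ : ι => complexGaussian) = (volume : Measure (ι → ℂ)).withDensity fun x =>
      ENNReal.ofReal (∏ i, Real.pi⁻¹ * Real.exp (-‖x i‖ ^ 2)) := by
  have hprob : IsProbabilityMeasure ((volume : Measure ℂ).withDensity fun z =>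
      ENNReal.ofReal (Real.pi⁻¹ * Real.exp (-‖z‖ ^ 2))) := by
    rw [← complexGaussian_eq_withDensity]
    infer_instance
  have := pi_withDensity (ι := ι) (volume : Measure ℂ)
    (f := fun z => ENNReal.ofReal (Real.pi⁻¹ * Real.exp (-‖z‖ ^ 2))) (by fun_prop)
    (fun z => by simpa using mul_pos (inv_pos.2 Real.pi_pos) (Real.exp_pos _))
    (fun z => ENNReal.ofReal_ne_top)
  rw [complexGaussian_eq_withDensity, this]
  congr 1
  funext x
  rw [ENNReal.ofReal_prod_of_nonneg fun i _ => by positivity]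

theorem isGaussianShaped_stdComplexGaussian : IsGaussianShaped (stdComplexGaussian ι) := by
  have h := isGaussianShaped_map (volume : Measure (ι → ℂ))
    (PiLp.continuousLinearEquiv 2 ℝ fun _ : ι => ℂ).symm
    (ENNReal.ofReal (Real.pi⁻¹ ^ Fintype.card ι))
  have hg : Measure.pi (fun _ : ι => complexGaussian) = (volume : Measure (ι → ℂ)).withDensity
      fun x => ENNReal.ofReal (Real.pi⁻¹ ^ Fintype.card ι) * ENNReal.ofReal
        (Real.exp (-‖(PiLp.continuousLinearEquiv 2 ℝ fun _ : ι => ℂ).symm x‖ ^ 2)) := by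
    rw [pi_complexGaussian_eq_withDensity]
    congr 1
    funext x
    rw [← ENNReal.ofReal_mul (by positivity), Finset.prod_mul_distrib, ← Real.exp_sum,
      EuclideanSpace.norm_sq_eq]
    simp
  rw [stdComplexGaussian, hg]
  exact h

/-- The Ginibre ensemble, read as a law on the Euclidean space of matrix entries. -/
theorem isGaussianShaped_ginibre (d : ℕ) :
    IsGaussianShaped ((ginibre d).map fun G =>
      (WithLp.toLp 2 fun p : Fin d × Fin d => G p.1 p.2 : EuclideanSpace ℂ (Fin d × Fin d))) := by
  have hprob : IsProbabilityMeasure ((volume : Measure (Fin d → ℂ)).withDensity fun x =>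
      ENNReal.ofReal (∏ i, Real.pi⁻¹ * Real.exp (-‖x i‖ ^ 2))) := by
    rw [← pi_complexGaussian_eq_withDensity]
    infer_instance
  have hpi := pi_withDensity (ι := Fin d) (volume : Measure (Fin d → ℂ))
    (f := fun x => ENNReal.ofReal (∏ i, Real.pi⁻¹ * Real.exp (-‖x i‖ ^ 2))) (by fun_prop)
    (fun z => by
      simpa using Finset.prod_pos fun i _ => mul_pos (inv_pos.2 Real.pi_pos) (Real.exp_pos _))
    (fun z => ENNReal.ofReal_ne_top)
  let e : (Fin d → Fin d → ℂ) ≃L[ℝ] EuclideanSpace ℂ (Fin d × Fin d) :=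
    ((LinearEquiv.curry ℝ ℂ (Fin d) (Fin d)).symm.toContinuousLinearEquiv).trans
      (PiLp.continuousLinearEquiv 2 ℝ fun _ : Fin d × Fin d => ℂ).symm
  have : (Measure.pi fun _ : Fin d => (volume : Measure (Fin d → ℂ))).IsAddHaarMeasure :=
    Measure.pi.isAddHaarMeasure _
  have h := isGaussianShaped_map (Measure.pi fun _ : Fin d => (volume : Measure (Fin d → ℂ))) e
    (ENNReal.ofReal ((Real.pi⁻¹ ^ d) ^ d))
  have he : ∀ G, e G = WithLp.toLp 2 fun p : Fin d × Fin d => G p.1 p.2 := fun G => rfl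
  have hg : ginibre d = (Measure.pi fun _ : Fin d => (volume : Measure (Fin d → ℂ))).withDensity
      fun G =>
      ENNReal.ofReal ((Real.pi⁻¹ ^ d) ^ d) * ENNReal.ofReal (Real.exp (-‖e G‖ ^ 2)) := by
    rw [ginibre, pi_complexGaussian_eq_withDensity, hpi]
    congr 1
    funext G
    rw [← ENNReal.ofReal_mul (by positivity),
      ← ENNReal.ofReal_prod_of_nonneg fun i _ => by positivity, he, EuclideanSpace.norm_sq_eq,
      Fintype.sum_prod_type]
    simp only [Finset.prod_mul_distrib, ← Real.exp_sum, Finset.sum_neg_distrib]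
    simp
  rw [hg]
  exact h

end StandardGaussian

/-! ### Polar coordinates for Gaussian measures -/

section Polar

variable {E : Type*} [NormedAddCommGroup E] [InnerProductSpace ℝ E] [FiniteDimensional ℝ E]
  [MeasurableSpace E] [BorelSpace E] [Nontrivial E]

/-- Integration in polar coordinates of a function of the direction times one of the norm. -/
theorem lintegral_direction_mul_norm {G : E → ℝ≥0∞} (hG : Measurable G) {h : ℝ → ℝ≥0∞}
    (hh : Measurable h) :
    ∫⁻ x : E, G (‖x‖⁻¹ • x) * h ‖x‖ =
      (∫⁻ ω, G (ω : Metric.sphere (0 : E) 1) ∂(volume : Measure E).toSphere) *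
        ∫⁻ r in Set.Ioi (0 : ℝ), ENNReal.ofReal (r ^ (Module.finrank ℝ E - 1)) * h r := by
  have hmp := (volume : Measure E).measurePreserving_homeomorphUnitSphereProd
  have hG' : Measurable fun ω : Metric.sphere (0 : E) 1 => G ω :=
    hG.comp measurable_subtype_coe
  have hh' : Measurable fun r : Set.Ioi (0 : ℝ) => h r := hh.comp measurable_subtype_coe
  have hΦ : Measurable fun y : Metric.sphere (0 : E) 1 × Set.Ioi (0 : ℝ) =>
      G (y.1 : E) * h (y.2 : ℝ) := (hG'.comp measurable_fst).mul (hh'.comp measurable_snd)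
  calc ∫⁻ x : E, G (‖x‖⁻¹ • x) * h ‖x‖
      = ∫⁻ x in ({0}ᶜ : Set E), G (‖x‖⁻¹ • x) * h ‖x‖ := by rw [restrict_compl_singleton]
    _ = ∫⁻ x : ({0}ᶜ : Set E), G (‖(x : E)‖⁻¹ • (x : E)) * h ‖(x : E)‖
          ∂(volume : Measure E).comap (↑) :=
        (lintegral_subtype_comap (measurableSet_singleton _).compl _).symm
    _ = ∫⁻ y, G (y.1 : E) * h (y.2 : ℝ) ∂((volume : Measure E).toSphere.prod
          (Measure.volumeIoiPow (Module.finrank ℝ E - 1))) := by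
        rw [← hmp.lintegral_comp hΦ]
        simp
    _ = _ := by
        rw [lintegral_prod_mul hG'.aemeasurable hh'.aemeasurable, Measure.volumeIoiPow,
          lintegral_withDensity_eq_lintegral_mul _ (by fun_prop) hh',
          ← lintegral_subtype_comap measurableSet_Ioi]
        rfl

variable {μ : Measure E} [IsProbabilityMeasure μ]

/-- The direction of a vector with a Gaussian-shaped law is uniform on the sphere and independent
of the norm. -/
theorem lintegral_direction_mul_norm_of_isGaussianShaped (hμ : IsGaussianShaped μ)
    {G : E → ℝ≥0∞} (hG : Measurable G) {h : ℝ → ℝ≥0∞} (hh : Measurable h) :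
    ∫⁻ x, G (‖x‖⁻¹ • x) * h ‖x‖ ∂μ =
      (((volume : Measure E).toSphere Set.univ)⁻¹ *
        ∫⁻ ω, G (ω : Metric.sphere (0 : E) 1) ∂(volume : Measure E).toSphere) *
        ∫⁻ x, h ‖x‖ ∂μ := by
  obtain ⟨c, rfl⟩ := hμ
  set σ := (volume : Measure E).toSphere with hσ
  set J : (ℝ → ℝ≥0∞) → ℝ≥0∞ := fun k => ∫⁻ r in Set.Ioi (0 : ℝ),
    ENNReal.ofReal (r ^ (Module.finrank ℝ E - 1)) *
      (k r * ENNReal.ofReal (Real.exp (-r ^ 2))) with hJ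
  have key : ∀ {G : E → ℝ≥0∞} (_ : Measurable G) {k : ℝ → ℝ≥0∞} (_ : Measurable k),
      ∫⁻ x, G (‖x‖⁻¹ • x) * k ‖x‖ ∂(c • (volume : Measure E).withDensity fun x =>
        ENNReal.ofReal (Real.exp (-‖x‖ ^ 2))) = c * ((∫⁻ ω, G ω ∂σ) * J k) := by
    intro G hG k hk
    rw [lintegral_smul_measure, lintegral_withDensity_eq_lintegral_mul _ (by fun_prop)
      (by fun_prop), smul_eq_mul, hσ, hJ, ← lintegral_direction_mul_norm hG (by fun_prop)]
    congr 1
    refine lintegral_congr fun x => ?_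
    simp only [Pi.mul_apply]
    ring
  have h1 := key (G := fun _ => 1) measurable_const (k := fun _ => 1) measurable_const
  simp only [mul_one, lintegral_const, measure_univ, one_mul] at h1
  have h2 := key (G := fun _ => 1) measurable_const hh
  simp only [one_mul, lintegral_const] at h2
  have hσ0 : σ Set.univ ≠ 0 := by
    rw [Measure.measure_univ_ne_zero]
    exact Measure.toSphere_ne_zero _
  have hσt : σ Set.univ ≠ ∞ := measure_ne_top _ _
  rw [key hG hh, h2]
  calc c * ((∫⁻ ω, G ω ∂σ) * J h)
      = ((σ Set.univ)⁻¹ * σ Set.univ) * (c * ((∫⁻ ω, G ω ∂σ) * J h)) := by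
        rw [ENNReal.inv_mul_cancel hσ0 hσt, one_mul]
    _ = _ := by ring

theorem lintegral_pow_mul_exp_neg_sq (n k : ℕ) :
    ∫⁻ r in Set.Ioi (0 : ℝ), ENNReal.ofReal (r ^ (2 * (n + 1) - 1)) *
      (ENNReal.ofReal r ^ (2 * k) * ENNReal.ofReal (Real.exp (-r ^ 2))) =
      ENNReal.ofReal ((n + k).factorial / 2) := by
  have hI : IntegrableOn (fun r : ℝ => r ^ (2 * ((n + k : ℕ) : ℝ) + 1) * Real.exp (-r ^ (2 : ℝ)))
      (Set.Ioi 0) := integrableOn_rpow_mul_exp_neg_rpow (by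
      have : (0 : ℝ) ≤ ((n + k : ℕ) : ℝ) := by positivity
      linarith) (by norm_num)
  have hG : ∫ r in Set.Ioi (0 : ℝ), r ^ (2 * ((n + k : ℕ) : ℝ) + 1) * Real.exp (-r ^ (2 : ℝ)) =
      (n + k).factorial / 2 := by
    rw [integral_rpow_mul_exp_neg_rpow (by norm_num) (by
      have : (0 : ℝ) ≤ ((n + k : ℕ) : ℝ) := by positivity
      linarith)]
    have : (2 * ((n + k : ℕ) : ℝ) + 1 + 1) / 2 = ((n + k : ℕ) : ℝ) + 1 := by ring
    rw [this, Real.Gamma_nat_eq_factorial]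
    ring
  rw [← hG, ofReal_integral_eq_lintegral_ofReal hI]
  · refine setLIntegral_congr_fun measurableSet_Ioi fun r hr => ?_
    have hr' : 0 ≤ r := le_of_lt hr
    have e1 : (2 * ((n + k : ℕ) : ℝ) + 1) = ((2 * (n + 1) - 1 + 2 * k : ℕ) : ℝ) := by
      have : 2 * (n + 1) - 1 + 2 * k = 2 * (n + k) + 1 := by omega
      rw [this]
      push_cast
      ring
    rw [e1, Real.rpow_natCast, Real.rpow_two, ← ENNReal.ofReal_pow hr',
      ← ENNReal.ofReal_mul (by positivity), ← ENNReal.ofReal_mul (by positivity), pow_add]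
    ring_nf
  · refine (ae_restrict_iff' measurableSet_Ioi).2 (Filter.Eventually.of_forall fun r hr => ?_)
    have hr' : 0 ≤ r := le_of_lt hr
    positivity

/-- The even moments of the norm of a Gaussian-shaped vector in complex dimension `n + 1`. -/
theorem lintegral_norm_pow_of_isGaussianShaped (hμ : IsGaussianShaped μ) {n : ℕ}
    (hn : Module.finrank ℝ E = 2 * (n + 1)) (k : ℕ) :
    ∫⁻ x, ‖x‖ₑ ^ (2 * k) ∂μ = ((n + 1).ascFactorial k : ℝ≥0∞) := by
  obtain ⟨c, rfl⟩ := hμ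
  set s := (volume : Measure E).toSphere Set.univ
  have key : ∀ k : ℕ, ∫⁻ x, ‖x‖ₑ ^ (2 * k) ∂(c • (volume : Measure E).withDensity fun x =>
        ENNReal.ofReal (Real.exp (-‖x‖ ^ 2))) = c * s * ENNReal.ofReal ((n + k).factorial / 2) := by
    intro k
    have := lintegral_direction_mul_norm (E := E) (G := fun _ => 1) measurable_const
      (h := fun r => ENNReal.ofReal r ^ (2 * k) * ENNReal.ofReal (Real.exp (-r ^ 2)))
      (by fun_prop)
    rw [hn, lintegral_pow_mul_exp_neg_sq] at this
    simp only [one_mul, lintegral_const] at this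
    rw [lintegral_smul_measure, lintegral_withDensity_eq_lintegral_mul _ (by fun_prop)
      (by fun_prop), smul_eq_mul, mul_assoc, ← this]
    congr 1
    refine lintegral_congr fun x => ?_
    simp only [Pi.mul_apply, ofReal_norm]
    ring
  have h0 := key 0
  simp only [mul_zero, pow_zero, lintegral_const, measure_univ, mul_one, add_zero] at h0
  have hfac : ((n + k).factorial / 2 : ℝ) = n.factorial / 2 * ((n + 1).ascFactorial k : ℕ) := by
    rw [← Nat.factorial_mul_ascFactorial]
    push_cast
    ring
  rw [key k, hfac, ENNReal.ofReal_mul (by positivity), ← mul_assoc, ← h0, one_mul,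
    ENNReal.ofReal_natCast]

end Polar

/-! ### Moments of complex Gaussian vectors -/

section Moments

variable {ι : Type*} [Fintype ι]

theorem finrank_real_euclideanSpace :
    Module.finrank ℝ (EuclideanSpace ℂ ι) = 2 * Fintype.card ι := by
  rw [← Module.finrank_mul_finrank ℝ ℂ, Complex.finrank_real_complex, finrank_euclideanSpace]

theorem lintegral_norm_pow_stdComplexGaussian [Nonempty ι] (k : ℕ) :
    ∫⁻ x, ‖x‖ₑ ^ (2 * k) ∂(stdComplexGaussian ι) = ((Fintype.card ι).ascFactorial k : ℝ≥0∞) := by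
  obtain ⟨n, hn⟩ := Nat.exists_eq_succ_of_ne_zero (Fintype.card_ne_zero (α := ι))
  rw [hn]
  refine lintegral_norm_pow_of_isGaussianShaped isGaussianShaped_stdComplexGaussian ?_ k
  rw [finrank_real_euclideanSpace, hn]

theorem lintegral_apply_stdComplexGaussian (i : ι) {f : ℂ → ℝ≥0∞} (hf : Measurable f) :
    ∫⁻ x, f (x i) ∂(stdComplexGaussian ι) = ∫⁻ z, f z ∂complexGaussian := by
  rw [stdComplexGaussian, lintegral_map (by fun_prop) (by fun_prop)]
  exact (measurePreserving_eval (fun _ : ι => complexGaussian) i).lintegral_comp hf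

theorem lintegral_norm_pow_complexGaussian (k : ℕ) :
    ∫⁻ z, ‖z‖ₑ ^ (2 * k) ∂complexGaussian = (k.factorial : ℝ≥0∞) := by
  have h := lintegral_norm_pow_stdComplexGaussian (ι := Unit) k
  rw [Fintype.card_unit, Nat.one_ascFactorial] at h
  rw [← h, ← lintegral_apply_stdComplexGaussian () (by fun_prop)]
  refine lintegral_congr fun x => ?_
  congr 1
  rw [← ofReal_norm, ← ofReal_norm, EuclideanSpace.norm_eq]
  simp

theorem lintegral_comp_linearIsometryEquiv_stdComplexGaussian
    (e : EuclideanSpace ℂ ι ≃ₗᵢ[ℂ] EuclideanSpace ℂ ι) {f : EuclideanSpace ℂ ι → ℝ≥0∞}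
    (hf : Measurable f) :
    ∫⁻ x, f (e x) ∂(stdComplexGaussian ι) = ∫⁻ x, f x ∂(stdComplexGaussian ι) := by
  obtain ⟨c, hc⟩ := isGaussianShaped_stdComplexGaussian (ι := ι)
  have he : MeasurePreserving e := by
    let e' : EuclideanSpace ℂ ι ≃ₗᵢ[ℝ] EuclideanSpace ℂ ι :=
      { e.toLinearEquiv.restrictScalars ℝ with norm_map' := e.norm_map }
    exact e'.measurePreserving
  have hmeas : Measurable e := e.continuous.measurable
  rw [hc, lintegral_smul_measure, lintegral_smul_measure,
    lintegral_withDensity_eq_lintegral_mul _ (by fun_prop) (by fun_prop),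
    lintegral_withDensity_eq_lintegral_mul _ (by fun_prop) hf]
  have h := he.lintegral_comp (f := fun x => ENNReal.ofReal (Real.exp (-‖x‖ ^ 2)) * f x)
    (by fun_prop)
  simp only [LinearIsometryEquiv.norm_map] at h
  congr 1

/-- A linear functional of a standard Gaussian vector is Gaussian, with the variance `‖v‖²`. -/
theorem lintegral_inner_pow_stdComplexGaussian (v : EuclideanSpace ℂ ι) (k : ℕ) :
    ∫⁻ x, ‖inner ℂ v x‖ₑ ^ (2 * k) ∂(stdComplexGaussian ι) =
      (k.factorial : ℝ≥0∞) * ‖v‖ₑ ^ (2 * k) := by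
  classical
  rcases eq_or_ne v 0 with rfl | hv
  · rcases Nat.eq_zero_or_pos k with rfl | hk
    · simp
    · simp [hk.ne']
  have hι : Nonempty ι := by
    by_contra h
    rw [not_nonempty_iff] at h
    exact hv (Subsingleton.elim _ _)
  obtain ⟨i₀⟩ := hι
  have hnv : ‖v‖ ≠ 0 := norm_ne_zero_iff.2 hv
  set w : EuclideanSpace ℂ ι := ((‖v‖⁻¹ : ℝ) : ℂ) • v with hw
  have hwn : ‖w‖ = 1 := by
    rw [hw, norm_smul, Complex.norm_real, norm_inv, norm_norm, inv_mul_cancel₀ hnv]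
  have hvw : v = ((‖v‖ : ℝ) : ℂ) • w := by
    rw [hw, smul_smul, ← Complex.ofReal_mul, mul_inv_cancel₀ hnv, Complex.ofReal_one, one_smul]
  obtain ⟨b, hb⟩ := Orthonormal.exists_orthonormalBasis_extension_of_card_eq
    (𝕜 := ℂ) (E := EuclideanSpace ℂ ι) (ι := ι) (by simp) (v := fun _ => w) (s := {i₀}) (by
      refine ⟨fun i => hwn, fun i j hij => absurd (Subsingleton.elim i j) hij⟩)
  have hin : ∀ x, inner ℂ v x = ((‖v‖ : ℝ) : ℂ) * b.repr x i₀ := by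
    intro x
    rw [b.repr_apply_apply, hb i₀ rfl]
    conv_lhs => rw [hvw]
    rw [inner_smul_left, Complex.conj_ofReal]
  simp only [hin, enorm_mul, mul_pow]
  rw [lintegral_const_mul _ (by fun_prop),
    lintegral_comp_linearIsometryEquiv_stdComplexGaussian b.repr
      (f := fun x => ‖x i₀‖ₑ ^ (2 * k)) (by fun_prop),
    lintegral_apply_stdComplexGaussian i₀ (f := fun z => ‖z‖ₑ ^ (2 * k)) (by fun_prop),
    lintegral_norm_pow_complexGaussian, mul_comm]
  congr 2
  rw [← ofReal_norm, Complex.norm_real, norm_norm, ofReal_norm]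

end Moments

/-! ### Moments of the operator norm of the Ginibre ensemble -/

section Ginibre

variable {d : ℕ}

/-- The entries of a matrix as a vector of the Euclidean space `ℂ^d ⊗ ℂ^d`. -/
def entryVector (G : Fin d → Fin d → ℂ) : EuclideanSpace ℂ (Fin d × Fin d) :=
  WithLp.toLp 2 fun p => G p.1 p.2

/-- The matrix entries of a vector of the Euclidean space `ℂ^d ⊗ ℂ^d`. -/
def vectorEntries (x : EuclideanSpace ℂ (Fin d × Fin d)) : Fin d → Fin d → ℂ := fun i j => x (i, j)

theorem measurable_entryVector : Measurable (entryVector (d := d)) := by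
  unfold entryVector
  fun_prop

theorem measurable_vectorEntries : Measurable (vectorEntries (d := d)) := by
  unfold vectorEntries
  fun_prop

theorem schattenTwoNorm_eq_norm_entryVector (G : Fin d → Fin d → ℂ) :
    schattenTwoNorm (Matrix.of G) = ‖entryVector G‖ := by
  rw [EuclideanSpace.norm_eq, schattenTwoNorm, Fintype.sum_prod_type]
  rfl

theorem measurable_toLp_mulVec : Measurable
    fun p : (Fin d → Fin d → ℂ) × EuclideanSpace ℂ (Fin d) =>
      (WithLp.toLp 2 (Matrix.of p.1 *ᵥ p.2.ofLp) : EuclideanSpace ℂ (Fin d)) := by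
  refine (WithLp.measurable_toLp 2 (Fin d → ℂ)).comp (measurable_pi_lambda _ fun i => ?_)
  change Measurable fun p : (Fin d → Fin d → ℂ) × EuclideanSpace ℂ (Fin d) =>
    ∑ j, p.1 i j * p.2 j
  fun_prop

/-- The total mass determines the constant of a Gaussian-shaped law. -/
theorem eq_of_isGaussianShaped {E : Type*} [NormedAddCommGroup E] [InnerProductSpace ℝ E]
    [FiniteDimensional ℝ E] [MeasurableSpace E] [BorelSpace E] {μ ν : Measure E}
    [IsProbabilityMeasure μ] [IsProbabilityMeasure ν] (hμ : IsGaussianShaped μ)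
    (hν : IsGaussianShaped ν) : μ = ν := by
  obtain ⟨a, rfl⟩ := hμ
  obtain ⟨b, rfl⟩ := hν
  set m := (volume : Measure E).withDensity fun x => ENNReal.ofReal (Real.exp (-‖x‖ ^ 2))
  have ha : a * m Set.univ = 1 := by
    rw [← smul_eq_mul, ← Measure.smul_apply]
    exact measure_univ
  have hb : b * m Set.univ = 1 := by
    rw [← smul_eq_mul, ← Measure.smul_apply]
    exact measure_univ
  rw [ENNReal.eq_inv_of_mul_eq_one_left ha, ENNReal.eq_inv_of_mul_eq_one_left hb]

instance : IsProbabilityMeasure (ginibre d) := by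
  unfold ginibre
  infer_instance

theorem map_entryVector_ginibre :
    (ginibre d).map entryVector = stdComplexGaussian (Fin d × Fin d) := by
  have : IsProbabilityMeasure ((ginibre d).map entryVector) :=
    Measure.isProbabilityMeasure_map measurable_entryVector.aemeasurable
  exact eq_of_isGaussianShaped (isGaussianShaped_ginibre d) isGaussianShaped_stdComplexGaussian

theorem lintegral_entryVector_ginibre {f : EuclideanSpace ℂ (Fin d × Fin d) → ℝ≥0∞}
    (hf : Measurable f) :
    ∫⁻ G, f (entryVector G) ∂(ginibre d) = ∫⁻ x, f x ∂(stdComplexGaussian (Fin d × Fin d)) := by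
  rw [← map_entryVector_ginibre, lintegral_map hf measurable_entryVector]

/-- The direction of a Ginibre matrix is uniform on the sphere and independent of its norm. -/
theorem lintegral_normalized_mul_norm_ginibre (hd : 0 < d) {F : (Fin d → Fin d → ℂ) → ℝ≥0∞}
    (hF : Measurable F) {h : ℝ → ℝ≥0∞} (hh : Measurable h) :
    ∫⁻ G, F (fun i j => G i j / (schattenTwoNorm (Matrix.of G) : ℂ)) *
        h (schattenTwoNorm (Matrix.of G)) ∂(ginibre d) =
      (∫⁻ L, F L ∂(uniformProgram d)) * ∫⁻ G, h (schattenTwoNorm (Matrix.of G)) ∂(ginibre d) := by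
  have : Nonempty (Fin d) := ⟨⟨0, hd⟩⟩
  have hFv : Measurable fun x => F (vectorEntries (d := d) x) := hF.comp measurable_vectorEntries
  have e1 := lintegral_direction_mul_norm_of_isGaussianShaped
    (isGaussianShaped_stdComplexGaussian (ι := Fin d × Fin d)) hFv hh
  have e2 := lintegral_entryVector_ginibre (d := d)
    (f := fun x => F (vectorEntries (‖x‖⁻¹ • x)) * h ‖x‖)
    ((hFv.comp (by fun_prop)).mul (hh.comp measurable_norm))
  have e3 := lintegral_entryVector_ginibre (d := d) (f := fun x => h ‖x‖) (hh.comp measurable_norm)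
  simp only [schattenTwoNorm_eq_norm_entryVector]
  have hm : Measurable fun (ψ : Metric.sphere (0 : EuclideanSpace ℂ (Fin d × Fin d)) 1) i j =>
      (ψ : EuclideanSpace ℂ (Fin d × Fin d)) (i, j) :=
    measurable_vectorEntries.comp measurable_subtype_coe
  rw [e3, uniformProgram, lintegral_map hF hm, lintegral_smul_measure, smul_eq_mul]
  refine Eq.trans (lintegral_congr fun G => ?_) (e2.trans e1)
  congr 2
  funext i j
  simp [vectorEntries, entryVector, div_eq_inv_mul]

theorem measurable_normalize : Measurable fun (G : Fin d → Fin d → ℂ) i j =>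
    G i j / (schattenTwoNorm (Matrix.of G) : ℂ) := by
  simp only [schattenTwoNorm_eq_norm_entryVector]
  have := (measurable_entryVector (d := d)).norm
  refine measurable_pi_lambda _ fun i => measurable_pi_lambda _ fun j => ?_
  exact Measurable.div (by fun_prop) (Complex.measurable_ofReal.comp this)

/-- The normalized Ginibre matrix is uniformly distributed on the unit sphere. -/
theorem normalizedGinibre_eq_uniformProgram (hd : 0 < d) :
    normalizedGinibre d = uniformProgram d := by
  refine Measure.ext fun s hs => ?_
  have h := lintegral_normalized_mul_norm_ginibre hd (F := s.indicator 1)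
    (measurable_one.indicator hs) (h := fun _ => 1) measurable_const
  simp only [mul_one, lintegral_const, measure_univ] at h
  rw [lintegral_indicator_one hs] at h
  rw [← h, normalizedGinibre, ← lintegral_indicator_one hs,
    lintegral_map (measurable_one.indicator hs) measurable_normalize]

instance : IsProbabilityMeasure (normalizedGinibre d) := by
  unfold normalizedGinibre
  exact Measure.isProbabilityMeasure_map measurable_normalize.aemeasurable

theorem continuous_l2_opNorm_of : Continuous fun G : Fin d → Fin d → ℂ => ‖Matrix.of G‖ :=
  continuous_norm.comp (continuous_id : Continuous fun G : Matrix (Fin d) (Fin d) ℂ => G)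

/-- The moments of the operator norm of a normalized Ginibre matrix, by independence of its
direction and its norm. -/
theorem lintegral_opNorm_normalizedGinibre (hd : 0 < d) (k : ℕ) :
    (∫⁻ L, ‖Matrix.of L‖ₑ ^ (2 * k) ∂(normalizedGinibre d)) * ((d * d).ascFactorial k : ℝ≥0∞) =
      ∫⁻ G, ‖Matrix.of G‖ₑ ^ (2 * k) ∂(ginibre d) := by
  have : Nonempty (Fin d) := ⟨⟨0, hd⟩⟩
  have hmeas : Measurable fun G : Fin d → Fin d → ℂ => ‖Matrix.of G‖ₑ ^ (2 * k) := by
    simp only [← ofReal_norm]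
    exact (ENNReal.measurable_ofReal.comp continuous_l2_opNorm_of.measurable).pow_const _
  have h := lintegral_normalized_mul_norm_ginibre hd hmeas
    (h := fun r => ENNReal.ofReal r ^ (2 * k)) (by fun_prop)
  have h2 : ∫⁻ G, ENNReal.ofReal (schattenTwoNorm (Matrix.of G)) ^ (2 * k) ∂(ginibre d) =
      ((d * d).ascFactorial k : ℝ≥0∞) := by
    simp only [schattenTwoNorm_eq_norm_entryVector, ofReal_norm]
    rw [lintegral_entryVector_ginibre (f := fun x => ‖x‖ₑ ^ (2 * k)) (by fun_prop),
      lintegral_norm_pow_stdComplexGaussian]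
    simp
  rw [normalizedGinibre_eq_uniformProgram hd, ← h2, ← h]
  refine lintegral_congr fun G => ?_
  rw [← mul_pow]
  congr 1
  rw [← ofReal_norm, ← ofReal_norm, ← ENNReal.ofReal_mul (norm_nonneg _)]
  congr 1
  have hs : (Matrix.of fun i j => G i j / (schattenTwoNorm (Matrix.of G) : ℂ)) =
      ((schattenTwoNorm (Matrix.of G) : ℂ))⁻¹ • Matrix.of G := by
    ext i j
    simp [div_eq_inv_mul]
  rw [hs, norm_smul, norm_inv, Complex.norm_real]
  have hnn : 0 ≤ schattenTwoNorm (Matrix.of G) := Real.sqrt_nonneg _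
  rw [Real.norm_of_nonneg hnn]
  rcases hnn.eq_or_lt with h0 | h0
  · have : G = 0 := by
      rw [schattenTwoNorm_eq_norm_entryVector] at h0
      have h1 := norm_eq_zero.1 h0.symm
      funext i j
      exact congrFun (congrArg WithLp.ofLp h1) (i, j)
    have h1 : Matrix.of G = 0 := this
    rw [h1]
    simp
  · field_simp

/-- A Ginibre matrix applied to a fixed vector `b` has Gaussian coordinates of variance `‖b‖²`. -/
theorem lintegral_mulVec_ginibre (hd : 0 < d) (b : EuclideanSpace ℂ (Fin d)) (k : ℕ) :
    ∫⁻ G, ‖(WithLp.toLp 2 (Matrix.of G *ᵥ b.ofLp) : EuclideanSpace ℂ (Fin d))‖ₑ ^ (2 * k)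
      ∂(ginibre d) = (d.ascFactorial k : ℝ≥0∞) * ‖b‖ₑ ^ (2 * k) := by
  have : Nonempty (Fin d) := ⟨⟨0, hd⟩⟩
  set v : (Fin d → Fin d → ℂ) → EuclideanSpace ℂ (Fin d) :=
    fun G => WithLp.toLp 2 (Matrix.of G *ᵥ b.ofLp) with hv
  have hvm : Measurable v := measurable_toLp_mulVec.comp (measurable_id.prodMk measurable_const)
  have hk : (k.factorial : ℝ≥0∞) ≠ 0 := by exact_mod_cast k.factorial_ne_zero
  refine (ENNReal.mul_right_inj hk (ENNReal.natCast_ne_top _)).1 ?_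
  -- The vector `w` with `⟨w, G⟩ = ⟨a, G b⟩`.
  set w : EuclideanSpace ℂ (Fin d) → EuclideanSpace ℂ (Fin d × Fin d) :=
    fun a => WithLp.toLp 2 fun p => a p.1 * star (b p.2) with hw
  have hin : ∀ a G, ‖inner ℂ (v G) a‖ₑ = ‖inner ℂ (w a) (entryVector G)‖ₑ := by
    intro a G
    rw [← ofReal_norm, ← ofReal_norm, norm_inner_symm]
    congr 2
    simp only [PiLp.inner_apply, hv, hw, entryVector, Fintype.sum_prod_type, Matrix.mulVec,
      dotProduct, Matrix.of_apply, RCLike.inner_apply, Finset.sum_mul, map_mul, Complex.star_def,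
      Complex.conj_conj]
    exact Finset.sum_congr rfl fun i _ => Finset.sum_congr rfl fun j _ => by ring
  have hwn : ∀ a, ‖w a‖ₑ = ‖a‖ₑ * ‖b‖ₑ := by
    intro a
    rw [← ofReal_norm, ← ofReal_norm, ← ofReal_norm, ← ENNReal.ofReal_mul (norm_nonneg _)]
    congr 1
    rw [← sq_eq_sq₀ (norm_nonneg _) (by positivity), mul_pow, EuclideanSpace.norm_sq_eq,
      EuclideanSpace.norm_sq_eq, EuclideanSpace.norm_sq_eq, Fintype.sum_prod_type,
      Finset.sum_mul_sum]
    simp [hw, mul_pow]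
  calc (k.factorial : ℝ≥0∞) * ∫⁻ G, ‖v G‖ₑ ^ (2 * k) ∂(ginibre d)
      = ∫⁻ G, ∫⁻ a, ‖inner ℂ (v G) a‖ₑ ^ (2 * k) ∂(stdComplexGaussian (Fin d)) ∂(ginibre d) := by
        rw [← lintegral_const_mul _ (by fun_prop)]
        exact lintegral_congr fun G => (lintegral_inner_pow_stdComplexGaussian _ _).symm
    _ = ∫⁻ a, ∫⁻ G, ‖inner ℂ (v G) a‖ₑ ^ (2 * k) ∂(ginibre d) ∂(stdComplexGaussian (Fin d)) := by
        refine lintegral_lintegral_swap (Measurable.aemeasurable ?_)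
        exact (((hvm.comp measurable_fst).inner measurable_snd).enorm).pow_const _
    _ = ∫⁻ a, (k.factorial : ℝ≥0∞) * (‖a‖ₑ * ‖b‖ₑ) ^ (2 * k) ∂(stdComplexGaussian (Fin d)) := by
        refine lintegral_congr fun a => ?_
        simp only [hin]
        rw [lintegral_entryVector_ginibre (f := fun x => ‖inner ℂ (w a) x‖ₑ ^ (2 * k))
          (by fun_prop), lintegral_inner_pow_stdComplexGaussian, hwn]
    _ = _ := by
        rw [lintegral_const_mul _ (by fun_prop)]
        congr 1
        simp only [mul_pow]
        rw [lintegral_mul_const _ (by fun_prop), lintegral_norm_pow_stdComplexGaussian,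
          Fintype.card_fin]

/-- The operator norm is controlled by the moments of `A b` for a Gaussian vector `b`: pair `A b`
with a vector on which the adjoint nearly attains its norm. -/
theorem factorial_mul_opNorm_pow_le (A : Op (Fin d)) (k : ℕ) :
    (k.factorial : ℝ≥0∞) * ‖A‖ₑ ^ (2 * k) ≤
      ∫⁻ b, ‖(WithLp.toLp 2 (A *ᵥ b.ofLp) : EuclideanSpace ℂ (Fin d))‖ₑ ^ (2 * k)
        ∂(stdComplexGaussian (Fin d)) := by
  set I := ∫⁻ b, ‖(WithLp.toLp 2 (A *ᵥ b.ofLp) : EuclideanSpace ℂ (Fin d))‖ₑ ^ (2 * k)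
        ∂(stdComplexGaussian (Fin d)) with hI
  set T := Matrix.toEuclideanCLM (n := Fin d) (𝕜 := ℂ) Aᴴ with hT
  have hTA : ‖T‖ = ‖A‖ := by
    rw [hT, Matrix.l2_opNorm_toEuclideanCLM, Matrix.l2_opNorm_conjTranspose]
  have hin : ∀ u b : EuclideanSpace ℂ (Fin d), inner ℂ (T u) b =
      inner ℂ u (WithLp.toLp 2 (A *ᵥ b.ofLp) : EuclideanSpace ℂ (Fin d)) := by
    intro u b
    rw [EuclideanSpace.inner_eq_star_dotProduct, EuclideanSpace.inner_eq_star_dotProduct, hT,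
      Matrix.ofLp_toEuclideanCLM, Matrix.star_mulVec, Matrix.conjTranspose_conjTranspose,
      dotProduct_comm, ← Matrix.dotProduct_mulVec, dotProduct_comm]
  have hu : ∀ u : EuclideanSpace ℂ (Fin d), ‖u‖ ≤ 1 →
      (k.factorial : ℝ≥0∞) * ‖T u‖ₑ ^ (2 * k) ≤ I := by
    intro u hu
    rw [← lintegral_inner_pow_stdComplexGaussian]
    refine lintegral_mono fun b => ?_
    gcongr
    rw [hin, ← ofReal_norm, ← ofReal_norm]
    refine ENNReal.ofReal_le_ofReal ((norm_inner_le_norm _ _).trans ?_)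
    exact mul_le_of_le_one_left (norm_nonneg _) hu
  rcases (norm_nonneg A).eq_or_lt with h0 | h0
  · have := hu 0 (by simp)
    simp only [map_zero, enorm_zero] at this
    rwa [← ofReal_norm, ← h0, ENNReal.ofReal_zero]
  · have hcont : Continuous fun r : ℝ => (k.factorial : ℝ≥0∞) * ENNReal.ofReal r ^ (2 * k) := by
      refine (ENNReal.continuous_const_mul (ENNReal.natCast_ne_top _)).comp ?_
      exact (ENNReal.continuous_pow _).comp ENNReal.continuous_ofReal
    have hlim := (hcont.tendsto ‖A‖).mono_left (nhdsWithin_le_nhds (s := Set.Iio ‖A‖))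
    simp only [ofReal_norm] at hlim
    refine le_of_tendsto hlim (eventually_mem_nhdsWithin.mono fun r hr => ?_)
    have hr' : r < ‖T‖ := hTA ▸ hr
    rcases lt_or_ge r 0 with hneg | hpos
    · refine le_trans ?_ (hu 0 (by simp))
      simp [ENNReal.ofReal_of_nonpos hneg.le]
    · obtain ⟨x, hx, hrx⟩ := T.exists_lt_apply_of_lt_opNorm hr'
      refine le_trans ?_ (hu x hx.le)
      gcongr
      rw [← ofReal_norm]
      exact ENNReal.ofReal_le_ofReal hrx.le

/-- Averaging the bound of `factorial_mul_opNorm_pow_le` over `G`: given `b`, the vector `G b` is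
Gaussian with variance `‖b‖²`, so each of the two integrals contributes a moment of a norm. -/
theorem lintegral_opNorm_ginibre_le (hd : 0 < d) (k : ℕ) :
    (k.factorial : ℝ≥0∞) * ∫⁻ G, ‖Matrix.of G‖ₑ ^ (2 * k) ∂(ginibre d) ≤
      (d.ascFactorial k : ℝ≥0∞) ^ 2 := by
  have : Nonempty (Fin d) := ⟨⟨0, hd⟩⟩
  have hmeas : Measurable fun G : Fin d → Fin d → ℂ => ‖Matrix.of G‖ₑ ^ (2 * k) := by
    simp only [← ofReal_norm]
    exact (ENNReal.measurable_ofReal.comp continuous_l2_opNorm_of.measurable).pow_const _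
  rw [← lintegral_const_mul _ hmeas]
  calc ∫⁻ G, (k.factorial : ℝ≥0∞) * ‖Matrix.of G‖ₑ ^ (2 * k) ∂(ginibre d)
      ≤ ∫⁻ G, ∫⁻ b, ‖(WithLp.toLp 2 (Matrix.of G *ᵥ b.ofLp) : EuclideanSpace ℂ (Fin d))‖ₑ ^ (2 * k)
          ∂(stdComplexGaussian (Fin d)) ∂(ginibre d) :=
        lintegral_mono fun G => factorial_mul_opNorm_pow_le _ _
    _ = ∫⁻ b, ∫⁻ G, ‖(WithLp.toLp 2 (Matrix.of G *ᵥ b.ofLp) : EuclideanSpace ℂ (Fin d))‖ₑ ^ (2 * k)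
          ∂(ginibre d) ∂(stdComplexGaussian (Fin d)) := by
        refine lintegral_lintegral_swap (Measurable.aemeasurable ?_)
        exact measurable_toLp_mulVec.enorm.pow_const _
    _ = _ := by
        simp only [lintegral_mulVec_ginibre hd]
        rw [lintegral_const_mul _ (by fun_prop), lintegral_norm_pow_stdComplexGaussian,
          Fintype.card_fin, sq]

/-- Tail bound for the operator norm of a normalized Ginibre matrix, from its moment of
order `2 k`. -/
theorem normalizedGinibre_opNorm_gt_le (hd : 0 < d) (k : ℕ) {y p : ℝ} (hy : 0 < y)
    (h : (d.ascFactorial k : ℝ) ^ 2 * d ^ k ≤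
      p * (k.factorial * (d * d).ascFactorial k * y ^ k)) :
    normalizedGinibre d {L | y < d * ‖Matrix.of L‖ ^ 2} ≤ ENNReal.ofReal p := by
  have hd' : (0 : ℝ) < d := by exact_mod_cast hd
  set ν := normalizedGinibre d
  set M := ∫⁻ L, ‖Matrix.of L‖ₑ ^ (2 * k) ∂ν with hM
  have hasc : 0 < (d * d).ascFactorial k := by
    have : 0 < d * d := by positivity
    obtain ⟨n, hn⟩ := Nat.exists_eq_succ_of_ne_zero this.ne'
    rw [hn]
    exact Nat.ascFactorial_pos _ _
  have h1 : (k.factorial : ℝ≥0∞) * (M * ((d * d).ascFactorial k : ℝ≥0∞)) ≤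
      (d.ascFactorial k : ℝ≥0∞) ^ 2 := by
    rw [lintegral_opNorm_normalizedGinibre hd]
    exact lintegral_opNorm_ginibre_le hd k
  have hmeas : Measurable fun G : Fin d → Fin d → ℂ => ‖Matrix.of G‖ₑ ^ (2 * k) := by
    simp only [← ofReal_norm]
    exact (ENNReal.measurable_ofReal.comp continuous_l2_opNorm_of.measurable).pow_const _
  have h2 : ENNReal.ofReal ((y / d) ^ k) * ν {L | y < d * ‖Matrix.of L‖ ^ 2} ≤ M := by
    refine le_trans ?_ (mul_meas_ge_le_lintegral hmeas (ENNReal.ofReal ((y / d) ^ k)))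
    refine mul_le_mul_right (measure_mono fun L hL => ?_) _
    have hL' : y / d < ‖Matrix.of L‖ ^ 2 := by
      rw [div_lt_iff₀ hd', mul_comm]
      exact hL
    change _ ≤ ‖Matrix.of L‖ₑ ^ (2 * k)
    rw [← ofReal_norm, ← ENNReal.ofReal_pow (norm_nonneg _), pow_mul]
    exact ENNReal.ofReal_le_ofReal (by gcongr)
  set c : ℝ := k.factorial * (d * d).ascFactorial k * (y / d) ^ k with hc
  have hfac : (0 : ℝ) < k.factorial := by exact_mod_cast k.factorial_pos
  have hasc' : (0 : ℝ) < (d * d).ascFactorial k := by exact_mod_cast hasc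
  have hcpos : 0 < c := by positivity
  have h3 : ENNReal.ofReal c * ν {L | y < d * ‖Matrix.of L‖ ^ 2} ≤ ENNReal.ofReal (c * p) := by
    calc ENNReal.ofReal c * ν {L | y < d * ‖Matrix.of L‖ ^ 2}
        = (k.factorial : ℝ≥0∞) * ((ENNReal.ofReal ((y / d) ^ k) *
            ν {L | y < d * ‖Matrix.of L‖ ^ 2}) * ((d * d).ascFactorial k : ℝ≥0∞)) := by
          rw [hc, ENNReal.ofReal_mul (by positivity), ENNReal.ofReal_mul (by positivity),
            ENNReal.ofReal_natCast, ENNReal.ofReal_natCast]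
          ring
      _ ≤ (k.factorial : ℝ≥0∞) * (M * ((d * d).ascFactorial k : ℝ≥0∞)) := by gcongr
      _ ≤ (d.ascFactorial k : ℝ≥0∞) ^ 2 := h1
      _ = ENNReal.ofReal ((d.ascFactorial k : ℝ) ^ 2) := by
          rw [ENNReal.ofReal_pow (by positivity), ENNReal.ofReal_natCast]
      _ ≤ ENNReal.ofReal (c * p) := by
          refine ENNReal.ofReal_le_ofReal ?_
          rw [hc, div_pow]
          calc (d.ascFactorial k : ℝ) ^ 2 = (d.ascFactorial k : ℝ) ^ 2 * d ^ k / d ^ k := by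
                field_simp
            _ ≤ p * (k.factorial * (d * d).ascFactorial k * y ^ k) / d ^ k := by gcongr
            _ = _ := by ring
  rw [ENNReal.ofReal_mul hcpos.le] at h3
  exact (ENNReal.mul_le_mul_iff_right (by simpa using hcpos) ENNReal.ofReal_ne_top).1 h3

end Ginibre

/-! ### The tail of the operator norm -/

/-- The Stirling-type bound `k! ≤ e k (k / e) ^ k`. -/
theorem factorial_mul_exp_le {k : ℕ} (hk : 0 < k) :
    (k.factorial : ℝ) * Real.exp k ≤ Real.exp 1 * k * (k : ℝ) ^ k := by
  induction k, hk using Nat.le_induction with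
  | base => simp
  | succ k hk ih =>
    have hk0 : (0 : ℝ) < k := by exact_mod_cast hk
    -- `(1 - 1 / (k + 1)) ^ (k + 1) ≤ 1 / e`
    have h1 : Real.exp 1 * (k : ℝ) ^ (k + 1) ≤ ((k + 1 : ℕ) : ℝ) ^ (k + 1) := by
      have h := Real.one_sub_div_pow_le_exp_neg (n := k + 1) (t := 1) (by push_cast; linarith)
      have h2 : (1 - 1 / ((k + 1 : ℕ) : ℝ)) = k / ((k + 1 : ℕ) : ℝ) := by
        push_cast
        field_simp
        ring
      rw [h2, div_pow, div_le_iff₀ (by positivity), Real.exp_neg] at h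
      rwa [le_inv_mul_iff₀ (Real.exp_pos 1)] at h
    calc ((k + 1).factorial : ℝ) * Real.exp ((k + 1 : ℕ) : ℝ)
        = ((k + 1 : ℕ) : ℝ) * Real.exp 1 * (k.factorial * Real.exp k) := by
          rw [Nat.factorial_succ]
          push_cast
          rw [Real.exp_add]
          ring
      _ ≤ ((k + 1 : ℕ) : ℝ) * Real.exp 1 * (Real.exp 1 * k * (k : ℝ) ^ k) := by gcongr
      _ = Real.exp 1 * ((k + 1 : ℕ) : ℝ) * (Real.exp 1 * (k : ℝ) ^ (k + 1)) := by ring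
      _ ≤ _ := by gcongr

/-- The term of index `k` in the binomial expansion of `(3/4 + 1/4) ^ (d + k)` is at most `1`. -/
theorem choose_add_le (d k : ℕ) : ((d + k).choose k : ℝ) ≤ (4 / 3) ^ k * 4 ^ d := by
  have h := add_pow (3 / 4 : ℝ) (1 / 4) (d + k)
  have h1 : (3 / 4 : ℝ) ^ k * (1 / 4) ^ (d + k - k) * ((d + k).choose k : ℝ) ≤ 1 := by
    have h2 : (3 / 4 + 1 / 4 : ℝ) ^ (d + k) = 1 := by norm_num
    refine le_trans ?_ (h.symm.trans h2).le
    exact Finset.single_le_sum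
      (f := fun m => (3 / 4 : ℝ) ^ m * (1 / 4) ^ (d + k - m) * ((d + k).choose m : ℝ))
      (fun i _ => by positivity)
      (Finset.mem_range.2 (Nat.lt_succ_of_le (Nat.le_add_left k d)))
  rw [Nat.add_sub_cancel] at h1
  calc ((d + k).choose k : ℝ)
      = (4 / 3) ^ k * 4 ^ d * ((3 / 4 : ℝ) ^ k * (1 / 4) ^ d * ((d + k).choose k : ℝ)) := by
        have e1 : (4 / 3 : ℝ) ^ k * (3 / 4) ^ k = 1 := by rw [← mul_pow]; norm_num
        have e2 : (4 : ℝ) ^ d * (1 / 4) ^ d = 1 := by rw [← mul_pow]; norm_num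
        linear_combination (-((d + k).choose k : ℝ) * 4 ^ d * (1 / 4) ^ d) * e1 -
          ((d + k).choose k : ℝ) * e2
    _ ≤ (4 / 3) ^ k * 4 ^ d * 1 := by gcongr
    _ = _ := mul_one _

theorem natCast_mul_pow_le (d : ℕ) : (d : ℝ) * (73 / 100) ^ d ≤ 6 / 5 := by
  rcases lt_or_ge d 4 with hd | hd
  · interval_cases d <;> norm_num
  · induction d, hd using Nat.le_induction with
    | base => norm_num
    | succ d hd ih =>
      have hd' : (4 : ℝ) ≤ d := by exact_mod_cast hd
      have hp : (0 : ℝ) < (73 / 100) ^ d := by positivity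
      refine le_trans ?_ ih
      rw [pow_succ]
      push_cast
      nlinarith

theorem succ_mul_half_pow_le (m : ℕ) : ((m : ℝ) + 1) * (1 / 2) ^ m ≤ 1 := by
  induction m with
  | zero => norm_num
  | succ m ih =>
    refine le_trans ?_ ih
    have hp : (0 : ℝ) < (1 / 2) ^ m := by positivity
    have hm : (0 : ℝ) ≤ m := by positivity
    rw [pow_succ]
    push_cast
    nlinarith

/-- The numerical estimate behind the tail bound, for the moment of order `6 N`, `N = d + m`, and
the threshold `11 N / (2 d)`. -/
theorem tail_numeric {d : ℕ} (hd : 0 < d) (m : ℕ) :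
    Real.exp 1 * ((3 * (d + m) : ℕ) : ℝ) * ((32 / 33) ^ (3 * (d + m))) * 16 ^ (d - 1) ≤
      2 * Real.exp (-(m + 1)) * Real.exp ((3 * (d + m) : ℕ) : ℝ) := by
  set e := Real.exp 1 with he
  have e1 : 2.7182 < e := by have := Real.exp_one_gt_d9; linarith
  have e2 : e < 2.7183 := by have := Real.exp_one_lt_d9; linarith
  have hepos : 0 < e := Real.exp_pos 1
  have hdR : (1 : ℝ) ≤ d := by exact_mod_cast hd
  have hmR : (0 : ℝ) ≤ m := by positivity
  set c : ℝ := (32 / 33) ^ 3 with hc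
  have h1 : 16 * c ≤ 73 / 100 * e ^ 3 := by
    have : (2.7182 : ℝ) ^ 3 ≤ e ^ 3 := by gcongr
    rw [hc]
    norm_num at this ⊢
    linarith
  have h2 : c ≤ 1 / 2 * e ^ 2 := by
    have : (2.7182 : ℝ) ^ 2 ≤ e ^ 2 := by gcongr
    rw [hc]
    norm_num at this ⊢
    linarith
  have hexp : Real.exp ((3 * (d + m) : ℕ) : ℝ) = e ^ (3 * d) * e ^ (2 * m) * e ^ m := by
    rw [← pow_add, ← pow_add, he, ← Real.exp_nat_mul]
    congr 1
    push_cast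
    ring
  have hexp2 : Real.exp (-(m + 1)) * (e ^ m * e) = 1 := by
    rw [he, ← Real.exp_nat_mul, ← Real.exp_add, ← Real.exp_add, Real.exp_eq_one_iff]
    ring
  have h16 : (16 : ℝ) ^ (d - 1) * 16 = 16 ^ d := by
    rw [← pow_succ, Nat.sub_add_cancel hd]
  have hA : (d : ℝ) * (16 * c) ^ d ≤ 6 / 5 * e ^ (3 * d) := by
    calc (d : ℝ) * (16 * c) ^ d ≤ d * (73 / 100 * e ^ 3) ^ d := by gcongr
      _ = d * (73 / 100) ^ d * e ^ (3 * d) := by rw [mul_pow, ← pow_mul]; ring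
      _ ≤ _ := by gcongr; exact natCast_mul_pow_le d
  have hB : ((m : ℝ) + 1) * c ^ m ≤ e ^ (2 * m) := by
    calc ((m : ℝ) + 1) * c ^ m ≤ (m + 1) * (1 / 2 * e ^ 2) ^ m := by gcongr
      _ = (m + 1) * (1 / 2) ^ m * e ^ (2 * m) := by rw [mul_pow, ← pow_mul]; ring
      _ ≤ 1 * e ^ (2 * m) := by gcongr; exact succ_mul_half_pow_le m
      _ = _ := one_mul _
  have hdm : (d : ℝ) + m ≤ d * (m + 1) := by nlinarith
  have hesq : e * (27 / 120) * e ≤ 2 := by nlinarith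
  calc e * ((3 * (d + m) : ℕ) : ℝ) * ((32 / 33) ^ (3 * (d + m))) * 16 ^ (d - 1)
      = e * (3 / 16) * (d + m) * (16 * c) ^ d * c ^ m := by
        rw [pow_mul, ← hc, mul_pow, ← h16]
        push_cast
        ring
    _ ≤ e * (3 / 16) * (d * (m + 1)) * (16 * c) ^ d * c ^ m := by gcongr
    _ = e * (3 / 16) * ((d * (16 * c) ^ d) * ((m + 1) * c ^ m)) := by ring
    _ ≤ e * (3 / 16) * ((6 / 5 * e ^ (3 * d)) * e ^ (2 * m)) := by gcongr
    _ = (e * (27 / 120) * e) * (Real.exp (-(m + 1)) * (e ^ (3 * d) * e ^ (2 * m) * e ^ m)) := by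
        linear_combination (-(27 / 120) * e * e ^ (3 * d) * e ^ (2 * m)) * hexp2
    _ ≤ 2 * (Real.exp (-(m + 1)) * (e ^ (3 * d) * e ^ (2 * m) * e ^ m)) := by gcongr
    _ = _ := by rw [hexp]; ring

/-- With `m` the integer part of `log (2 / δ)`, the squared operator norm exceeds
`11 / 2 * (1 + m / d) / d` with probability at most `δ`. -/
theorem normalizedGinibre_tail {d : ℕ} (hd : 0 < d) {δ : ℝ} (hδ : 0 < δ) :
    normalizedGinibre d
        {L | 11 / 2 * (1 + (⌊Real.log (2 / δ)⌋₊ : ℝ) / d) < d * ‖Matrix.of L‖ ^ 2} ≤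
      ENNReal.ofReal δ := by
  set m := ⌊Real.log (2 / δ)⌋₊ with hm
  have hdR : (0 : ℝ) < d := by exact_mod_cast hd
  set k := 3 * (d + m) with hk
  have hkpos : 0 < k := by omega
  refine normalizedGinibre_opNorm_gt_le hd k (by positivity) ?_
  have hδm : 2 * Real.exp (-(m + 1)) ≤ δ := by
    have h := Nat.lt_floor_add_one (Real.log (2 / δ))
    rw [← hm] at h
    rw [Real.log_lt_iff_lt_exp (by positivity), div_lt_iff₀ hδ] at h
    rw [Real.exp_neg, ← div_eq_mul_inv, div_le_iff₀ (Real.exp_pos _), mul_comm]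
    exact h.le
  have hchoose : ((d + k - 1).choose k : ℝ) ≤ (4 / 3) ^ k * 4 ^ (d - 1) := by
    have := choose_add_le (d - 1) k
    rwa [show d - 1 + k = d + k - 1 by omega] at this
  have hasc : ((d : ℝ) * d) ^ k ≤ ((d * d).ascFactorial k : ℝ) := by
    exact_mod_cast Nat.pow_succ_le_ascFactorial (d * d) k
  have hfac : (0 : ℝ) < k.factorial := by exact_mod_cast k.factorial_pos
  have hkR : (0 : ℝ) < k := by exact_mod_cast hkpos
  have hthr : 11 / 2 * (1 + (m : ℝ) / d) * d = 11 / 6 * k := by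
    rw [hk]
    push_cast
    field_simp
    ring
  -- the estimate for `k! * choose²`
  have hmain : (k.factorial : ℝ) * ((d + k - 1).choose k : ℝ) ^ 2 ≤ δ * (11 / 6 * k) ^ k := by
    refine le_of_mul_le_mul_right ?_ (Real.exp_pos k)
    calc (k.factorial : ℝ) * ((d + k - 1).choose k : ℝ) ^ 2 * Real.exp k
        = (k.factorial * Real.exp k) * ((d + k - 1).choose k : ℝ) ^ 2 := by ring
      _ ≤ (Real.exp 1 * k * (k : ℝ) ^ k) * ((4 / 3) ^ k * 4 ^ (d - 1)) ^ 2 := by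
          exact mul_le_mul (factorial_mul_exp_le hkpos) (by gcongr) (by positivity)
            (by positivity)
      _ = (Real.exp 1 * k * (32 / 33) ^ k * 16 ^ (d - 1)) * (11 / 6 * k) ^ k := by
          have e1 : ((4 / 3 : ℝ) ^ k) ^ 2 = (32 / 33) ^ k * (11 / 6) ^ k := by
            rw [← pow_mul, mul_comm k 2, pow_mul, ← mul_pow]
            norm_num
          have e2 : ((4 : ℝ) ^ (d - 1)) ^ 2 = 16 ^ (d - 1) := by
            rw [← pow_mul, mul_comm _ 2, pow_mul]
            norm_num
          rw [mul_pow, e1, e2, mul_pow]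
          ring
      _ ≤ (2 * Real.exp (-(m + 1)) * Real.exp k) * (11 / 6 * k) ^ k := by
          exact mul_le_mul_of_nonneg_right (tail_numeric hd m) (by positivity)
      _ ≤ (δ * Real.exp k) * (11 / 6 * k) ^ k := by gcongr
      _ = _ := by ring
  calc (d.ascFactorial k : ℝ) ^ 2 * d ^ k
      = (k.factorial * (k.factorial * ((d + k - 1).choose k : ℝ) ^ 2)) * d ^ k := by
        rw [Nat.ascFactorial_eq_factorial_mul_choose']
        push_cast
        ring
    _ ≤ (k.factorial * (δ * (11 / 6 * k) ^ k)) * d ^ k := by gcongr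
    _ = δ * (k.factorial * ((d : ℝ) * d) ^ k * (11 / 2 * (1 + (m : ℝ) / d)) ^ k) := by
        rw [← hthr, mul_pow, mul_pow (d : ℝ)]
        ring
    _ ≤ _ := by gcongr

/-- On the typical event the simulation error is controlled by `7 / 2 * (1 + l / d)`. In small
dimensions the trivial bound `K ≤ 1` enters. -/
theorem rate_le {d : ℕ} {K l : ℝ} (hd : 0 < d) (hK0 : 0 ≤ K) (hK1 : K ≤ 1)
    (hl : 1 / 2 ≤ l) (hK : d * K ≤ 11 / 2 * (1 + (⌊l⌋₊ : ℝ) / d)) :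
    d * K / 2 + K ^ 2 ≤ 7 / 2 * (1 + l / d) := by
  have hl0 : (0 : ℝ) ≤ l := by linarith
  have hfl : (⌊l⌋₊ : ℝ) ≤ l := Nat.floor_le hl0
  have hK2 : K ^ 2 ≤ K := by nlinarith
  have hdR : (0 : ℝ) < d := by exact_mod_cast hd
  have hld : 0 ≤ l / d := by positivity
  have hdK : d * K ≤ d := mul_le_of_le_one_right hdR.le hK1
  rcases le_or_gt d 5 with h5 | h5
  · have : (d : ℝ) ≤ 5 := by exact_mod_cast h5
    linarith
  set m := ⌊l⌋₊ with hm
  rcases le_or_gt 8 d with h8 | h8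
  · have h8' : (8 : ℝ) ≤ d := by exact_mod_cast h8
    set s := 1 + (m : ℝ) / d with hs
    have hs1 : 1 ≤ s := by
      have : 0 ≤ (m : ℝ) / d := by positivity
      linarith
    have hsl : s ≤ 1 + l / d := by
      rw [hs]
      gcongr
    rcases le_or_gt (4 / 3) s with h | h
    · linarith
    · have : 8 * K ≤ 11 / 2 * s := le_trans (by gcongr) hK
      nlinarith
  · have hml : (m : ℝ) = 0 ∨ (m : ℝ) = 1 ∨ (2 : ℝ) ≤ m := by
      rcases Nat.lt_or_ge m 2 with h | h
      · interval_cases m <;> simp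
      · right; right; exact_mod_cast h
    have hd67 : d = 6 ∨ d = 7 := by omega
    rcases hd67 with rfl | rfl <;> rcases hml with h | h | h <;>
      (norm_num at hK hdK ⊢; try rw [h] at hK hfl) <;> nlinarith

theorem ae_sum_norm_sq_normalizedGinibre {d : ℕ} (hd : 0 < d) :
    ∀ᵐ L ∂(normalizedGinibre d), ∑ i, ∑ j, ‖L i j‖ ^ 2 = 1 := by
  have hm : Measurable fun (ψ : Metric.sphere (0 : EuclideanSpace ℂ (Fin d × Fin d)) 1) i j =>
      (ψ : EuclideanSpace ℂ (Fin d × Fin d)) (i, j) :=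
    measurable_vectorEntries.comp measurable_subtype_coe
  rw [normalizedGinibre_eq_uniformProgram hd, uniformProgram]
  refine (ae_map_iff hm.aemeasurable (measurableSet_eq_fun (by fun_prop) measurable_const)).2
    (Filter.Eventually.of_forall fun ψ => ?_)
  have h : ‖(ψ : EuclideanSpace ℂ (Fin d × Fin d))‖ ^ 2 = 1 := by
    rw [norm_eq_of_mem_sphere ψ, one_pow]
  rw [EuclideanSpace.norm_sq_eq, Fintype.sum_prod_type] at h
  exact h

theorem log_two_div_ge {δ : ℝ} (hδ : 0 < δ) (hδ1 : δ < 1) : 1 / 2 ≤ Real.log (2 / δ) := by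
  have h1 : Real.log 2 ≤ Real.log (2 / δ) :=
    Real.log_le_log (by norm_num) ((le_div_iff₀ hδ).2 (by linarith))
  have := Real.log_two_gt_d9
  linarith

/-- With probability at least `1 - δ`, the jump operator is normalized and its simulation rate is
at most `7 / 2 * (1 + log (2 / δ) / d)`. -/
theorem normalizedGinibre_typical {d : ℕ} (hd : 0 < d) {δ : ℝ} (hδ : 0 < δ) (hδ1 : δ < 1) :
    ENNReal.ofReal (1 - δ) ≤ normalizedGinibre d {L | ∑ i, ∑ j, ‖L i j‖ ^ 2 = 1 ∧
      d * ‖Matrix.of L‖ ^ 2 / 2 + (‖Matrix.of L‖ ^ 2) ^ 2 ≤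
        7 / 2 * (1 + Real.log (2 / δ) / d)} := by
  set T := {L : Fin d → Fin d → ℂ | ∑ i, ∑ j, ‖L i j‖ ^ 2 = 1 ∧
      d * ‖Matrix.of L‖ ^ 2 / 2 + (‖Matrix.of L‖ ^ 2) ^ 2 ≤
        7 / 2 * (1 + Real.log (2 / δ) / d)} with hT
  set S := {L : Fin d → Fin d → ℂ |
    11 / 2 * (1 + (⌊Real.log (2 / δ)⌋₊ : ℝ) / d) < d * ‖Matrix.of L‖ ^ 2} with hS
  rw [ENNReal.ofReal_sub _ hδ.le, ENNReal.ofReal_one, tsub_le_iff_right]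
  have hle : ∀ᵐ L ∂(normalizedGinibre d), L ∈ (Set.univ : Set (Fin d → Fin d → ℂ)) →
      L ∈ T ∪ S := by
    filter_upwards [ae_sum_norm_sq_normalizedGinibre hd] with L hL _
    by_cases hLS : L ∈ S
    · exact Or.inr hLS
    · refine Or.inl ⟨hL, rate_le hd (by positivity) ?_ (log_two_div_ge hδ hδ1) (not_lt.1 hLS)⟩
      exact (l2_opNorm_sq_le_sum _).trans hL.le
  calc (1 : ℝ≥0∞) = normalizedGinibre d Set.univ := measure_univ.symm
    _ ≤ normalizedGinibre d (T ∪ S) := measure_mono_ae hle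
    _ ≤ normalizedGinibre d T + normalizedGinibre d S := measure_union_le _ _
    _ ≤ _ := by
        gcongr
        exact normalizedGinibre_tail hd hδ

/-! ### Typical sample complexity -/

theorem typicalSampleComplexity_le_of_rate {d : ℕ} (hd : 0 < d) {n : ℕ} (hn : 0 < n)
    {t ε δ : ℝ} (ht : 0 ≤ t) (hδ : 0 < δ) (hδ1 : δ < 1)
    (h : 7 / 2 * (1 + Real.log (2 / δ) / d) * (t ^ 2 / n) ≤ ε) :
    typicalSampleComplexity (normalizedGinibre d) t ε δ ≤ n := by
  obtain ⟨P, hP, hL⟩ := exists_channel_simulationError_le hd hn ht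
  refine iInf₂_le n ⟨P, hP, (normalizedGinibre_typical hd hδ hδ1).trans (measure_mono ?_)⟩
  rintro L ⟨hL1, hL2⟩
  refine (hL (Matrix.of L) hL1).trans (ENNReal.ofReal_le_ofReal (le_trans ?_ h))
  gcongr

theorem typicalSampleComplexity_zero (d : ℕ) {ε δ : ℝ} (hδ : 0 < δ) :
    typicalSampleComplexity (normalizedGinibre d) 0 ε δ = 0 := by
  obtain ⟨P, hP, hL⟩ := exists_channel_simulationError_zero (d := d)
  have h : typicalSampleComplexity (normalizedGinibre d) 0 ε δ ≤ (0 : ℕ) := by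
    refine iInf₂_le 0 ⟨P, hP, ?_⟩
    have hs : {L : Fin d → Fin d → ℂ | simulationError P (Matrix.of L) 0 ≤ ENNReal.ofReal ε} =
        Set.univ := Set.eq_univ_of_forall fun L => by simp [hL]
    rw [hs, measure_univ, ENNReal.ofReal_le_one]
    linarith
  simpa using h

/-- The sample complexity is at most `⌊B⌋` if `B ≥ 1`, and at most `⌈B⌉` in general; rounding down
costs a factor of at most two in the number of samples. -/
theorem typicalSampleComplexity_normalizedGinibre_le {d : ℕ} (hd : 0 < d) {t ε δ B : ℝ}
    (ht : 0 ≤ t) (hε : 0 < ε) (hδ : 0 < δ) (hδ1 : δ < 1)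
    (hB : 7 * (1 + Real.log (2 / δ) / d) * (t ^ 2 / ε) ≤ B) :
    typicalSampleComplexity (normalizedGinibre d) t ε δ ≤ (⌈B⌉₊ : ℕ∞) ∧
      (1 ≤ B → (typicalSampleComplexity (normalizedGinibre d) t ε δ : ℝ≥0∞) ≤
        ENNReal.ofReal B) := by
  rcases ht.eq_or_lt with rfl | ht0
  · rw [typicalSampleComplexity_zero d hδ]
    simp
  have hlog : 0 ≤ Real.log (2 / δ) := by linarith [log_two_div_ge hδ hδ1]
  have hBpos : 0 < B := lt_of_lt_of_le (by positivity) hB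
  have key : ∀ n : ℕ, 0 < n → B ≤ 2 * n →
      typicalSampleComplexity (normalizedGinibre d) t ε δ ≤ n := by
    intro n hn hBn
    refine typicalSampleComplexity_le_of_rate hd hn ht hδ hδ1 ?_
    have hnR : (0 : ℝ) < n := by exact_mod_cast hn
    have h := hB.trans hBn
    rw [← mul_div_assoc, div_le_iff₀ hε] at h
    rw [← mul_div_assoc, div_le_iff₀ hnR]
    linarith
  refine ⟨key _ (Nat.ceil_pos.2 hBpos) ?_, fun h1 => ?_⟩
  · have := Nat.le_ceil B
    have h0 : (0 : ℝ) ≤ (⌈B⌉₊ : ℝ) := by positivity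
    linarith
  · have hfl : 1 ≤ ⌊B⌋₊ := (Nat.one_le_floor_iff B).2 h1
    have hflR : (1 : ℝ) ≤ (⌊B⌋₊ : ℝ) := by exact_mod_cast hfl
    have hlt := Nat.lt_floor_add_one B
    have h := key ⌊B⌋₊ hfl (by linarith)
    calc (typicalSampleComplexity (normalizedGinibre d) t ε δ : ℝ≥0∞)
        ≤ (((⌊B⌋₊ : ℕ) : ℕ∞) : ℝ≥0∞) := ENat.toENNReal_le.2 h
      _ = ENNReal.ofReal (⌊B⌋₊ : ℝ) := by simp
      _ ≤ ENNReal.ofReal B := ENNReal.ofReal_le_ofReal (Nat.floor_le hBpos.le)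

end SampleSim

end

theorem theorem2 :
    (∀ d : ℕ, 2 ≤ d →
      SampleSim.normalizedGinibre d = SampleSim.uniformProgram d ∧
      ∀ t ε δ : ℝ, 0 ≤ t → 0 < ε → ε < 1 → 0 < δ → δ < 1 →
        SampleSim.typicalSampleComplexity (SampleSim.normalizedGinibre d) t ε δ ≤
            (⌈7 * (1 + Real.log (2 / δ) / d) * (t ^ 2 / ε)⌉₊ : ℕ∞) ∧
        (1 ≤ 7 * (1 + Real.log (2 / δ) / d) * (t ^ 2 / ε) →
          (SampleSim.typicalSampleComplexity (SampleSim.normalizedGinibre d) t ε δ : ℝ≥0∞) ≤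
            ENNReal.ofReal (7 * (1 + Real.log (2 / δ) / d) * (t ^ 2 / ε)))) ∧
    (∀ δ C : ℝ, 0 < δ → δ < 1 → 7 < C →
      ∃ D : ℕ, ∀ d : ℕ, 2 ≤ d → D ≤ d → ∀ t ε : ℝ, 0 ≤ t → 0 < ε → ε < 1 →
        SampleSim.typicalSampleComplexity (SampleSim.normalizedGinibre d) t ε δ ≤
            (⌈C * (t ^ 2 / ε)⌉₊ : ℕ∞) ∧
        (1 ≤ C * (t ^ 2 / ε) →
          (SampleSim.typicalSampleComplexity (SampleSim.normalizedGinibre d) t ε δ : ℝ≥0∞) ≤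
            ENNReal.ofReal (C * (t ^ 2 / ε)))) := by
  refine ⟨fun d hd => ⟨SampleSim.normalizedGinibre_eq_uniformProgram (by omega),
    fun t ε δ ht hε _ hδ hδ1 => SampleSim.typicalSampleComplexity_normalizedGinibre_le (by omega)
      ht hε hδ hδ1 le_rfl⟩, fun δ C hδ hδ1 hC => ?_⟩
  refine ⟨⌈7 * Real.log (2 / δ) / (C - 7)⌉₊, fun d hd hD t ε ht hε _ =>
    SampleSim.typicalSampleComplexity_normalizedGinibre_le (by omega) ht hε hδ hδ1 ?_⟩
  have hdR : (0 : ℝ) < d := by exact_mod_cast (by omega : 0 < d)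
  have h := (Nat.le_ceil _).trans (Nat.cast_le.2 hD)
  rw [div_le_iff₀ (by linarith)] at h
  have h2 : 7 * Real.log (2 / δ) / d ≤ C - 7 := by
    rw [div_le_iff₀ hdR]
    linarith
  gcongr
  rw [mul_div_assoc] at h2
  linarith
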